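/- Let $\mathbf k$ be a field of characteristic zero. A \emph{nonunital operad} is a sequence $\mathcal S=\{\mathcal S(n)\}_{n\ge 1}$ of $\mathbb Z$-graded $\mathbf k$-vector spaces with degree-preserving left $\mathbf k$-linear actions of the symmetric groups $\Sigma_n$, together with degree $0$ linear maps $\circ_i:\mathcal S(m)\otimes\mathcal S(n)\to\mathcal S(m+n-1)$, $1\le i\le n$ ($f\circ_i g$ is "$f$ plugged into the $i$-th input of $g$"), which satisfy, for $f\in\mathcal S(a)$, $g\in\mathcal S(b)$, $h\in\mathcal S(c)$ homogeneous, $$ f\circ_i(g\circ_j h)=\begin{cases}(-1)^{|f||g|}\,g\circ_{j+a-1}(f\circ_i h), & 1\le i\le j-1,\\ (f\circ_{i-j+1}g)\circ_j h, & j\le i\le j+b-1,\\ (-1)^{|f||g|}\,g\circ_j(f\circ_{i-b+1}h), & i\ge j+b,\end{cases} $$ and which are equivariant: $(\sigma f)\circ_{\tau(i)}(\tau g)=(\sigma\circ_i\tau)(f\circ_i g)$ for $\sigma\in\Sigma_m$, $\tau\in\Sigma_n$, where $\sigma\circ_i\tau\in\Sigma_{m+n-1}$ is obtained by inserting $\sigma$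 at the $i$-th place of $\tau$. A \emph{differential} on $\mathcal S$ is a family of $\Sigma_n$-equivariant linear maps $d:\mathcal S(n)\to\mathcal S(n)$ of degree $-1$ with $d^2=0$ and $d(f\circ_i g)=d(f)\circ_i g+(-1)^{|f|}f\circ_i d(g)$; then $(\mathcal S,d)$ is a \emph{dg operad}. Homomorphisms of (dg) operads are equivariant linear maps of degree $0$ commuting with all $\circ_i$ (and with the differentials). A \emph{collection} is a sequence $M=\{M(n)\}_{n\ge 2}$ of $\mathbb Z$-graded $\mathbf k$-vector spaces with degree-preserving $\mathbf k$-linear $\Sigma_n$-actions. $\mathcal F(M)$ denotes the free nonunital operad on $M$, $\mathcal F^l(M)\subset\mathcal F(M)$ the span of the elements obtained from $l$ elements of $M$ by the operations $\circ_i$ and the actions of the symmetric groups, and $\mathcal F^{\ge 2}(M)=\bigoplus_{l\ge 2}\mathcal F^l(M)$. **Theorem.** Let $(\mathcal S,d_{\mathcal S})$ be a dg operad over $\mathbf k$ with $\mathcal S(1)=0$. Then there exist a collection $M$, a differential $d$ on $\mathcal F(M)$ and a homomorphism of dg operads $\nu:(\mathcal F(M),d)\to(\mathcal S,d_{\mathcal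 S})$ such that 1. $d$ is minimal: $d(M)\subset\mathcal F^{\ge 2}(M)$; 2. $\nu$ induces an isomorphism in homology. Such a $\nu$ is called a minimal model of $(\mathcal S,d_{\mathcal S})$. It is unique in the following sense: if $\nu:(\mathcal F(M),d)\to(\mathcal S,d_{\mathcal S})$ and $\nu':(\mathcal F(M'),d')\to(\mathcal S,d_{\mathcal S})$ are two minimal models of $(\mathcal S,d_{\mathcal S})$, then the dg operads $(\mathcal F(M),d)$ and $(\mathcal F(M'),d')$ are isomorphic. -/

import Mathlib

universe u v w

/-- A sequence of `ℤ`-graded `k`-vector spaces with actions of the symmetric groups: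
`obj n p` is the degree `p` part of the `n`-th space, and `Σ_n` acts on it (from the left). -/
structure SymmSeq (k : Type u) [Field k] where
  obj : ℕ → ℤ → Type v
  [addCommGroup : ∀ n p, AddCommGroup (obj n p)]
  [module : ∀ n p, Module k (obj n p)]
  act : ∀ n p, Representation k (Equiv.Perm (Fin n)) (obj n p)

attribute [instance] SymmSeq.addCommGroup SymmSeq.module

/-- A collection `{E(n); n ≥ 2}` of graded vector spaces with `Σ_n`-actions; the sequence is
extended by `E(0) = E(1) = 0`. -/
structure OperadCollection (k : Type u) [Field k] extends SymmSeq.{u, v} k where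
  subsingleton_obj : ∀ n p, n < 2 → Subsingleton (obj n p)

namespace OperadPerm

/-- The position, among the `m + n - 1` inputs of `f ∘_i g`, of an input of `f` or of an input of
`g` other than the `i`-th (everything is numbered from `0`): the `m` inputs of `f` are inserted at
the `i`-th place. -/
def blockFun {m n r : ℕ} (h : m + n = r + 1) (i : Fin n) :
    Fin m ⊕ {j : Fin n // j ≠ i} → Fin r
  | Sum.inl a => ⟨i + a, by omega⟩
  | Sum.inr j => if hj : j.1 < i then ⟨j.1, by omega⟩ else
      ⟨j.1 + m - 1, by have := j.2; have := j.1.2; omega⟩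

theorem blockFun_bijective {m n r : ℕ} (h : m + n = r + 1) (i : Fin n) :
    Function.Bijective (blockFun h i) := by
  rw [Fintype.bijective_iff_injective_and_card]
  constructor
  · rintro (a | ⟨a, ha⟩) (b | ⟨b, hb⟩) hab
    · simp only [blockFun, Fin.mk.injEq] at hab
      congr 1; ext; omega
    · exfalso
      simp only [blockFun] at hab
      split_ifs at hab with h1 <;> simp only [Fin.mk.injEq] at hab <;> omega
    · exfalso
      simp only [blockFun] at hab
      split_ifs at hab with h1 <;> simp only [Fin.mk.injEq] at hab <;> omega
    · simp only [blockFun] at hab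
      congr 2; ext
      split_ifs at hab with h1 h2 h2 <;> simp only [Fin.mk.injEq] at hab <;> omega
  · have := i.2
    simp [Fintype.card_subtype_compl]
    omega

/-- `blockFun` as a bijection. -/
noncomputable def block {m n r : ℕ} (h : m + n = r + 1) (i : Fin n) :
    Fin m ⊕ {j : Fin n // j ≠ i} ≃ Fin r :=
  Equiv.ofBijective (blockFun h i) (blockFun_bijective h i)

/-- The permutation `σ ∘_i τ ∈ Σ_{m+n-1}` obtained by inserting `σ ∈ Σ_m` at the `i`-th place in
`τ ∈ Σ_n`: the block of `m` elements at place `i` is permuted by `σ` and is carried,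
as a whole, to place `τ i`, while the other elements are permuted by `τ`. -/
noncomputable def insertPerm {m n r : ℕ} (h : m + n = r + 1) (σ : Equiv.Perm (Fin m))
    (τ : Equiv.Perm (Fin n)) (i : Fin n) : Equiv.Perm (Fin r) :=
  (block h i).symm.trans <|
    (Equiv.sumCongr σ (τ.subtypeEquiv fun j => by simp)).trans (block h (τ i))

end OperadPerm

/-- A (graded, symmetric) nonunital operad `{S(n); n ≥ 1}`, extended by `S(0) = 0`.
For `f ∈ S(m)_p` and `g ∈ S(n)_q`, the element `comp hn hp i f g ∈ S(r)_s`, where `r = m + n - 1`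
and `s = p + q`, is `f ∘_i g`, that is, `f` is plugged into the `i`-th input of `g`.
Inputs are numbered from `0`, that is, `i : Fin n`.  In the left action of `Σ_n`, the `j`-th input
of `g` is the `τ j`-th input of `τ g`. -/
structure NonunitalOperad (k : Type u) [Field k] extends SymmSeq.{u, v} k where
  subsingleton_obj_zero : ∀ p, Subsingleton (obj 0 p)
  comp : ∀ {m n r : ℕ} {p q s : ℤ}, m + n = r + 1 → p + q = s → Fin n →
    (obj m p →ₗ[k] obj n q →ₗ[k] obj r s)
  /-- `f ∘_i (g ∘_j h) = (f ∘_{i-j} g) ∘_j h` if the `i`-th input of `g ∘_j h` belongs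
  to `g`. -/
  comp_assoc : ∀ {a b c ab bc abc : ℕ} {p q r pq qr pqr : ℤ}
    (hab : a + b = ab + 1) (hbc : b + c = bc + 1)
    (hl : ab + c = abc + 1) (hr : a + bc = abc + 1)
    (hpq : p + q = pq) (hqr : q + r = qr) (hl' : pq + r = pqr) (hr' : p + qr = pqr)
    (i : Fin bc) (j : Fin c) (i' : Fin b) (_ : (i : ℕ) = i' + j)
    (f : obj a p) (g : obj b q) (h : obj c r),
    comp hr hr' i f (comp hbc hqr j g h) = comp hl hl' j (comp hab hpq i' f g) h
  /-- `f ∘_i (g ∘_j h) = (-1)^{|f||g|} g ∘_{j+a-1} (f ∘_i h)` for `i < j`; read from right to left,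
  this is also the relation for an input `i ≥ j + b` of `g ∘_j h`. -/
  comp_comm : ∀ {a b c ac bc abc : ℕ} {p q r pr qr pqr : ℤ}
    (hac : a + c = ac + 1) (hbc : b + c = bc + 1)
    (hl : b + ac = abc + 1) (hr : a + bc = abc + 1)
    (hpr : p + r = pr) (hqr : q + r = qr) (hl' : q + pr = pqr) (hr' : p + qr = pqr)
    (i j : Fin c) (_ : i < j) (i' : Fin bc) (_ : (i' : ℕ) = i)
    (j' : Fin ac) (_ : (j' : ℕ) + 1 = j + a)
    (f : obj a p) (g : obj b q) (h : obj c r),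
    comp hr hr' i' f (comp hbc hqr j g h) =
      (-1 : k) ^ (p * q) • comp hl hl' j' g (comp hac hpr i f h)
  /-- Equivariance of the compositions. -/
  comp_act : ∀ {m n r : ℕ} {p q s : ℤ} (hn : m + n = r + 1) (hp : p + q = s)
    (σ : Equiv.Perm (Fin m)) (τ : Equiv.Perm (Fin n)) (i : Fin n) (f : obj m p) (g : obj n q),
    comp hn hp (τ i) (act m p σ f) (act n q τ g) =
      act r s (OperadPerm.insertPerm hn σ τ i) (comp hn hp i f g)

/-- A homomorphism of nonunital operads. -/
structure OperadHom {k : Type u} [Field k] (P : NonunitalOperad.{u, v} k)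
    (Q : NonunitalOperad.{u, w} k) where
  toFun : ∀ n p, P.obj n p →ₗ[k] Q.obj n p
  map_act : ∀ {n p} (σ : Equiv.Perm (Fin n)) (f : P.obj n p),
    toFun n p (P.act n p σ f) = Q.act n p σ (toFun n p f)
  map_comp : ∀ {m n r : ℕ} {p q s : ℤ} (hn : m + n = r + 1) (hp : p + q = s) (i : Fin n)
    (f : P.obj m p) (g : P.obj n q),
    toFun r s (P.comp hn hp i f g) = Q.comp hn hp i (toFun m p f) (toFun n q g)

/-- A differential on an operad: a derivation `d` of degree `-1` with `d² = 0`. -/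
structure OperadDifferential {k : Type u} [Field k] (P : NonunitalOperad.{u, v} k) where
  d : ∀ (n : ℕ) {p q : ℤ}, q + 1 = p → (P.obj n p →ₗ[k] P.obj n q)
  d_act : ∀ {n : ℕ} {p q : ℤ} (h : q + 1 = p) (σ : Equiv.Perm (Fin n)) (f : P.obj n p),
    d n h (P.act n p σ f) = P.act n q σ (d n h f)
  d_comp : ∀ {m n r : ℕ} {p q s p' q' s' : ℤ} (hn : m + n = r + 1) (hp : p + q = s)
    (hp' : p' + 1 = p) (hq' : q' + 1 = q) (hs' : s' + 1 = s)
    (h₁ : p' + q = s') (h₂ : p + q' = s') (i : Fin n) (f : P.obj m p) (g : P.obj n q),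
    d r hs' (P.comp hn hp i f g) =
      P.comp hn h₁ i (d m hp' f) g + (-1 : k) ^ p • P.comp hn h₂ i f (d n hq' g)
  d_d : ∀ {n : ℕ} {p q r : ℤ} (h : q + 1 = p) (h' : r + 1 = q) (f : P.obj n p),
    d n h' (d n h f) = 0

namespace OperadDifferential

variable {k : Type u} [Field k] {P : NonunitalOperad.{u, v} k} (D : OperadDifferential P)

/-- The degree `p` cycles in arity `n`. -/
def cycles (n : ℕ) (p : ℤ) : Submodule k (P.obj n p) :=
  LinearMap.ker (D.d n (sub_add_cancel p 1))

/-- The degree `p` boundaries in arity `n`. -/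
def boundaries (n : ℕ) (p : ℤ) : Submodule k (P.obj n p) :=
  LinearMap.range (D.d n (rfl : p + 1 = p + 1))

/-- The homology `H_p(P(n), d(n))`: cycles modulo boundaries. -/
abbrev homology (n : ℕ) (p : ℤ) : Type v :=
  D.cycles n p ⧸ (D.boundaries n p).submoduleOf (D.cycles n p)

end OperadDifferential

/-- A homomorphism `(P, D) → (Q, E)` of differential graded operads. -/
structure DGOperadHom {k : Type u} [Field k] {P : NonunitalOperad.{u, v} k}
    {Q : NonunitalOperad.{u, w} k} (D : OperadDifferential P) (E : OperadDifferential Q)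
    extends OperadHom P Q where
  map_d : ∀ {n : ℕ} {p q : ℤ} (h : q + 1 = p) (f : P.obj n p),
    toFun n q (D.d n h f) = E.d n h (toFun n p f)

namespace DGOperadHom

variable {k : Type u} [Field k] {P : NonunitalOperad.{u, v} k} {Q : NonunitalOperad.{u, w} k}
  {D : OperadDifferential P} {E : OperadDifferential Q} (φ : DGOperadHom D E)

/-- The map induced on cycles. -/
def cyclesMap (n : ℕ) (p : ℤ) : D.cycles n p →ₗ[k] E.cycles n p :=
  (φ.toFun n p).restrict fun x hx => by
    have hx' : D.d n (sub_add_cancel p 1) x = 0 := hx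
    change E.d n (sub_add_cancel p 1) (φ.toFun n p x) = 0
    rw [← φ.map_d, hx', map_zero]

/-- The map induced in homology. -/
def homologyMap (n : ℕ) (p : ℤ) : D.homology n p →ₗ[k] E.homology n p :=
  Submodule.mapQ _ _ (φ.cyclesMap n p) (by
    rintro ⟨x, hx⟩ ⟨y, hy⟩
    exact ⟨φ.toFun n (p + 1) y, by
      rw [← φ.map_d]
      exact congrArg (φ.toFun n p) hy⟩)

/-- The homomorphism induces an isomorphism in homology. -/
def IsHomologyIso : Prop :=
  ∀ n p, Function.Bijective (φ.homologyMap n p)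

end DGOperadHom

/-- An isomorphism of differential graded operads: a pair of mutually inverse homomorphisms. -/
structure DGOperadIso {k : Type u} [Field k] {P : NonunitalOperad.{u, v} k}
    {Q : NonunitalOperad.{u, w} k} (D : OperadDifferential P) (E : OperadDifferential Q) where
  hom : DGOperadHom D E
  inv : DGOperadHom E D
  hom_inv : ∀ n p (f : P.obj n p), inv.toFun n p (hom.toFun n p f) = f
  inv_hom : ∀ n p (g : Q.obj n p), hom.toFun n p (inv.toFun n p g) = g

/-! The free nonunital operad `F(M)` on a collection `M`: formal expressions in the elements of
`M`, modulo the congruence generated by the axioms of a nonunital operad and by the requirement that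
`M → F(M)` be a map of collections. -/

namespace FreeOperad

/-- Formal expressions of given arity and degree. -/
inductive Term {k : Type u} [Field k] (M : OperadCollection.{u, v} k) :
    ℕ → ℤ → Type (max u v)
  | gen {n p} (x : M.obj n p) : Term M n p
  | zero {n p} : Term M n p
  | add {n p} (s t : Term M n p) : Term M n p
  | smul {n p} (c : k) (t : Term M n p) : Term M n p
  | act {n p} (σ : Equiv.Perm (Fin n)) (t : Term M n p) : Term M n p
  | comp {m n r p q s} (hn : m + n = r + 1) (hp : p + q = s) (i : Fin n)
      (f : Term M m p) (g : Term M n q) : Term M r s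

open Term in
/-- The congruence generated by the axioms. -/
inductive Rel {k : Type u} [Field k] (M : OperadCollection.{u, v} k) :
    ∀ {n : ℕ} {p : ℤ}, Term M n p → Term M n p → Prop
  -- equivalence relation
  | refl {n p} (t : Term M n p) : Rel M t t
  | symm {n p} {s t : Term M n p} : Rel M s t → Rel M t s
  | trans {n p} {s t r : Term M n p} : Rel M s t → Rel M t r → Rel M s r
  -- compatibility with the operations
  | add {n p} {s s' t t' : Term M n p} : Rel M s s' → Rel M t t' → Rel M (add s t) (add s' t')
  | smul {n p} (c : k) {t t' : Term M n p} : Rel M t t' → Rel M (smul c t) (smul c t')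
  | act {n p} (σ : Equiv.Perm (Fin n)) {t t' : Term M n p} :
      Rel M t t' → Rel M (act σ t) (act σ t')
  | comp {m n r p q s} (hn : m + n = r + 1) (hp : p + q = s) (i : Fin n)
      {f f' : Term M m p} {g g' : Term M n q} :
      Rel M f f' → Rel M g g' → Rel M (comp hn hp i f g) (comp hn hp i f' g')
  -- vector spaces
  | add_comm {n p} (s t : Term M n p) : Rel M (add s t) (add t s)
  | add_assoc {n p} (s t r : Term M n p) : Rel M (add (add s t) r) (add s (add t r))
  | zero_add {n p} (t : Term M n p) : Rel M (add zero t) t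
  | neg_add {n p} (t : Term M n p) : Rel M (add (smul (-1) t) t) zero
  | smul_add {n p} (c : k) (s t : Term M n p) :
      Rel M (smul c (add s t)) (add (smul c s) (smul c t))
  | add_smul {n p} (c e : k) (t : Term M n p) :
      Rel M (smul (c + e) t) (add (smul c t) (smul e t))
  | mul_smul {n p} (c e : k) (t : Term M n p) : Rel M (smul (c * e) t) (smul c (smul e t))
  | one_smul {n p} (t : Term M n p) : Rel M (smul 1 t) t
  -- linear actions of the symmetric groups
  | act_one {n p} (t : Term M n p) : Rel M (act 1 t) t
  | act_mul {n p} (σ τ : Equiv.Perm (Fin n)) (t : Term M n p) :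
      Rel M (act (σ * τ) t) (act σ (act τ t))
  | act_add {n p} (σ : Equiv.Perm (Fin n)) (s t : Term M n p) :
      Rel M (act σ (add s t)) (add (act σ s) (act σ t))
  | act_smul {n p} (σ : Equiv.Perm (Fin n)) (c : k) (t : Term M n p) :
      Rel M (act σ (smul c t)) (smul c (act σ t))
  -- `M → F(M)` is linear and equivariant
  | gen_add {n p} (x y : M.obj n p) : Rel M (gen (x + y)) (add (gen x) (gen y))
  | gen_smul {n p} (c : k) (x : M.obj n p) : Rel M (gen (c • x)) (smul c (gen x))
  | gen_act {n p} (σ : Equiv.Perm (Fin n)) (x : M.obj n p) :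
      Rel M (gen (M.act n p σ x)) (act σ (gen x))
  -- bilinearity of the compositions
  | comp_add_left {m n r p q s} (hn : m + n = r + 1) (hp : p + q = s) (i : Fin n)
      (f f' : Term M m p) (g : Term M n q) :
      Rel M (comp hn hp i (add f f') g) (add (comp hn hp i f g) (comp hn hp i f' g))
  | comp_smul_left {m n r p q s} (hn : m + n = r + 1) (hp : p + q = s) (i : Fin n)
      (c : k) (f : Term M m p) (g : Term M n q) :
      Rel M (comp hn hp i (smul c f) g) (smul c (comp hn hp i f g))
  | comp_add_right {m n r p q s} (hn : m + n = r + 1) (hp : p + q = s) (i : Fin n)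
      (f : Term M m p) (g g' : Term M n q) :
      Rel M (comp hn hp i f (add g g')) (add (comp hn hp i f g) (comp hn hp i f g'))
  | comp_smul_right {m n r p q s} (hn : m + n = r + 1) (hp : p + q = s) (i : Fin n)
      (c : k) (f : Term M m p) (g : Term M n q) :
      Rel M (comp hn hp i f (smul c g)) (smul c (comp hn hp i f g))
  -- the axioms of a nonunital operad
  | comp_assoc {a b c ab bc abc : ℕ} {p q r pq qr pqr : ℤ}
      (hab : a + b = ab + 1) (hbc : b + c = bc + 1)
      (hl : ab + c = abc + 1) (hr : a + bc = abc + 1)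
      (hpq : p + q = pq) (hqr : q + r = qr) (hl' : pq + r = pqr) (hr' : p + qr = pqr)
      (i : Fin bc) (j : Fin c) (i' : Fin b) (_ : (i : ℕ) = i' + j)
      (f : Term M a p) (g : Term M b q) (h : Term M c r) :
      Rel M (comp hr hr' i f (comp hbc hqr j g h)) (comp hl hl' j (comp hab hpq i' f g) h)
  | comp_comm {a b c ac bc abc : ℕ} {p q r pr qr pqr : ℤ}
      (hac : a + c = ac + 1) (hbc : b + c = bc + 1)
      (hl : b + ac = abc + 1) (hr : a + bc = abc + 1)
      (hpr : p + r = pr) (hqr : q + r = qr) (hl' : q + pr = pqr) (hr' : p + qr = pqr)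
      (i j : Fin c) (_ : i < j) (i' : Fin bc) (_ : (i' : ℕ) = i)
      (j' : Fin ac) (_ : (j' : ℕ) + 1 = j + a)
      (f : Term M a p) (g : Term M b q) (h : Term M c r) :
      Rel M (comp hr hr' i' f (comp hbc hqr j g h))
        (smul ((-1 : k) ^ (p * q)) (comp hl hl' j' g (comp hac hpr i f h)))
  | comp_act {m n r p q s} (hn : m + n = r + 1) (hp : p + q = s)
      (σ : Equiv.Perm (Fin m)) (τ : Equiv.Perm (Fin n)) (i : Fin n)
      (f : Term M m p) (g : Term M n q) :
      Rel M (comp hn hp (τ i) (act σ f) (act τ g))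
        (act (OperadPerm.insertPerm hn σ τ i) (comp hn hp i f g))

variable {k : Type u} [Field k] (M : OperadCollection.{u, v} k)

/-- The congruence as a setoid. -/
def relSetoid (n : ℕ) (p : ℤ) : Setoid (Term M n p) where
  r := Rel M
  iseqv := ⟨Rel.refl, Rel.symm, Rel.trans⟩

/-- The space `F(M)(n)_p`. -/
def Obj (n : ℕ) (p : ℤ) : Type (max u v) := Quotient (relSetoid M n p)

variable {M}

/-- The class of an expression. -/
def mk {n : ℕ} {p : ℤ} (t : Term M n p) : Obj M n p := Quotient.mk (relSetoid M n p) t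

theorem mk_eq {n : ℕ} {p : ℤ} {s t : Term M n p} (h : Rel M s t) : mk s = mk t :=
  Quotient.sound h

theorem mk_surjective {n : ℕ} {p : ℤ} (x : Obj M n p) : ∃ t, mk t = x := Quotient.exists_rep x

instance (n : ℕ) (p : ℤ) : Zero (Obj M n p) := ⟨mk .zero⟩

instance (n : ℕ) (p : ℤ) : Add (Obj M n p) :=
  ⟨Quotient.map₂ .add fun _ _ h _ _ h' => Rel.add h h'⟩

instance (n : ℕ) (p : ℤ) : SMul k (Obj M n p) :=
  ⟨fun c => Quotient.map (.smul c) fun _ _ h => Rel.smul c h⟩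

instance (n : ℕ) (p : ℤ) : Neg (Obj M n p) := ⟨fun x => (-1 : k) • x⟩

instance (n : ℕ) (p : ℤ) : AddCommGroup (Obj M n p) :=
  have hcomm : ∀ x y : Obj M n p, x + y = y + x := by
    rintro ⟨x⟩ ⟨y⟩; exact mk_eq (Rel.add_comm x y)
  have hzero : ∀ x : Obj M n p, 0 + x = x := by
    rintro ⟨x⟩; exact mk_eq (Rel.zero_add x)
  { add_assoc := by rintro ⟨x⟩ ⟨y⟩ ⟨z⟩; exact mk_eq (Rel.add_assoc x y z)
    zero_add := hzero
    add_zero := fun x => (hcomm x 0).trans (hzero x)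
    add_comm := hcomm
    neg_add_cancel := by rintro ⟨x⟩; exact mk_eq (Rel.neg_add x)
    nsmul := nsmulRec
    zsmul := zsmulRec }

instance (n : ℕ) (p : ℤ) : Module k (Obj M n p) :=
  Module.ofMinimalAxioms
    (by rintro c ⟨x⟩ ⟨y⟩; exact mk_eq (Rel.smul_add c x y))
    (by rintro c e ⟨x⟩; exact mk_eq (Rel.add_smul c e x))
    (by rintro c e ⟨x⟩; exact mk_eq (Rel.mul_smul c e x))
    (by rintro ⟨x⟩; exact mk_eq (Rel.one_smul x))

variable (M)

/-- The map of collections `M → F(M)`. -/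
def ι (n : ℕ) (p : ℤ) : M.obj n p →ₗ[k] Obj M n p where
  toFun x := mk (.gen x)
  map_add' x y := mk_eq (Rel.gen_add x y)
  map_smul' c x := mk_eq (Rel.gen_smul c x)

/-- The action of `Σ_n` on `F(M)(n)_p`. -/
def act (n : ℕ) (p : ℤ) : Representation k (Equiv.Perm (Fin n)) (Obj M n p) where
  toFun σ :=
    { toFun := Quotient.map (.act σ) fun _ _ h => Rel.act σ h
      map_add' := by rintro ⟨x⟩ ⟨y⟩; exact mk_eq (Rel.act_add σ x y)
      map_smul' := by rintro c ⟨x⟩; exact mk_eq (Rel.act_smul σ c x) }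
  map_one' := by ext ⟨x⟩; exact mk_eq (Rel.act_one x)
  map_mul' σ τ := by ext ⟨x⟩; exact mk_eq (Rel.act_mul σ τ x)

/-- The compositions `∘_i` of `F(M)`. -/
def comp {m n r : ℕ} {p q s : ℤ} (hn : m + n = r + 1) (hp : p + q = s) (i : Fin n) :
    Obj M m p →ₗ[k] Obj M n q →ₗ[k] Obj M r s :=
  LinearMap.mk₂ k (Quotient.map₂ (.comp hn hp i) fun _ _ h _ _ h' => Rel.comp hn hp i h h')
    (by rintro ⟨x⟩ ⟨y⟩ ⟨z⟩; exact mk_eq (Rel.comp_add_left hn hp i x y z))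
    (by rintro c ⟨x⟩ ⟨y⟩; exact mk_eq (Rel.comp_smul_left hn hp i c x y))
    (by rintro ⟨x⟩ ⟨y⟩ ⟨z⟩; exact mk_eq (Rel.comp_add_right hn hp i x y z))
    (by rintro c ⟨x⟩ ⟨y⟩; exact mk_eq (Rel.comp_smul_right hn hp i c x y))

theorem mk_eq_zero {n : ℕ} {p : ℤ} (t : Term M n p) (hn : n = 0) : mk t = 0 := by
  induction t with
  | @gen n p x =>
    have := M.subsingleton_obj n p (by omega)
    rw [Subsingleton.elim x 0]
    exact map_zero (ι M n p)
  | zero => rfl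
  | add s t hs ht =>
    change mk s + mk t = 0
    rw [hs hn, ht hn, add_zero]
  | smul c t ht =>
    change c • mk t = 0
    rw [ht hn, smul_zero]
  | act σ t ht =>
    change act M _ _ σ (mk t) = 0
    rw [ht hn, map_zero]
  | comp h hp i f g hf hg =>
    change comp M h hp i (mk f) (mk g) = 0
    rw [hf (by have := i.2; omega), map_zero, LinearMap.zero_apply]

end FreeOperad

/-- The free nonunital operad `F(M)` on a collection `M`. -/
def freeOperad {k : Type u} [Field k] (M : OperadCollection.{u, v} k) :
    NonunitalOperad.{u, max u v} k where
  obj := FreeOperad.Obj M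
  act := FreeOperad.act M
  subsingleton_obj_zero p := subsingleton_of_forall_eq 0 (by
    rintro ⟨t⟩; exact FreeOperad.mk_eq_zero M t rfl)
  comp := FreeOperad.comp M
  comp_assoc hab hbc hl hr hpq hqr hl' hr' i j i' hi := by
    rintro ⟨f⟩ ⟨g⟩ ⟨h⟩
    exact FreeOperad.mk_eq
      (FreeOperad.Rel.comp_assoc hab hbc hl hr hpq hqr hl' hr' i j i' hi f g h)
  comp_comm hac hbc hl hr hpr hqr hl' hr' i j hij i' hi' j' hj' := by
    rintro ⟨f⟩ ⟨g⟩ ⟨h⟩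
    exact FreeOperad.mk_eq
      (FreeOperad.Rel.comp_comm hac hbc hl hr hpr hqr hl' hr' i j hij i' hi' j' hj' f g h)
  comp_act hn hp σ τ i := by
    rintro ⟨f⟩ ⟨g⟩
    exact FreeOperad.mk_eq (FreeOperad.Rel.comp_act hn hp σ τ i f g)

namespace FreeOperad

variable {k : Type u} [Field k] {M : OperadCollection.{u, v} k}

/-- `x` is a word of length `l`: it is obtained from `l` elements of `M` by the compositions `∘_i`
and the actions of the symmetric groups (it corresponds to a tree with `l` vertices, that is, with
`l - 1` inner edges). -/
inductive IsWord : ℕ → ∀ {n : ℕ} {p : ℤ}, (freeOperad M).obj n p → Prop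
  | gen {n p} (x : M.obj n p) : IsWord 1 (ι M n p x)
  | act {l n p} (σ : Equiv.Perm (Fin n)) {x : (freeOperad M).obj n p} :
      IsWord l x → IsWord l ((freeOperad M).act n p σ x)
  | comp {l l' m n r p q s} (hn : m + n = r + 1) (hp : p + q = s) (i : Fin n)
      {x : (freeOperad M).obj m p} {y : (freeOperad M).obj n q} :
      IsWord l x → IsWord l' y → IsWord (l + l') ((freeOperad M).comp hn hp i x y)

variable (M)

/-- The part `F^l(M)(n)_p` spanned by the words of length `l`. -/
def lengthPart (l n : ℕ) (p : ℤ) : Submodule k ((freeOperad M).obj n p) :=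
  Submodule.span k {x | IsWord l x}

/-- `F^{≥ l}(M)(n)_p`, the sum of the `F^j(M)(n)_p` with `j ≥ l`. -/
def lengthGE (l n : ℕ) (p : ℤ) : Submodule k ((freeOperad M).obj n p) :=
  ⨆ j ≥ l, lengthPart M j n p

variable {M}

/-- A differential `d` on `F(M)` is minimal if `d(M) ⊆ F^{≥ 2}(M)`. -/
def IsMinimal (D : OperadDifferential (freeOperad M)) : Prop :=
  ∀ (n : ℕ) (p q : ℤ) (h : q + 1 = p) (x : M.obj n p),
    D.d n h (ι M n p x) ∈ lengthGE M 2 n q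

end FreeOperad

universe v₁ v₂ v₃

/-! A collection starts in arity 2, so F(M) vanishes in arities 0 and 1, and both factors of a
nonzero composition have strictly smaller arity than the result. Hence the decomposable elements of
arity n, which form F^{≥2}(M)(n) (`lengthGE_two`), are built from generators of arity < n, and every
construction proceeds by induction on the arity. Characteristic zero allows linear choices to be
averaged over Σ_n and so made equivariant (Maschke).

Existence. Let ν : F(M) → S be a homology isomorphism in arities ≤ N + 1, with no generators in
higher arities. In arity N + 2 the defect of ν is the homology of its mapping cone. Choose a
Σ-stable complement of the boundaries in the cycles, and make each of its elements (c, s) a new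
generator y with d y = c and ν y = s. This c is decomposable because there were no generators of
arity N + 2 before, so minimality persists; lower arities do not change
(`ModelUpTo.nonempty_extension`). The limit over all arities is a minimal model
(`exists_minimal_model`).

Uniqueness. One model is enlarged to F(M' ⊕ W) with W contractible, such that the map π to S becomes
surjective (`exists_factorization`). The enlargement does not change homology: a contraction of W
extends to a derivation s, and d s + s d multiplies a word by its number of factors in W, which is
invertible when positive (`exists_contractible_extension`). By minimality the other model lifts
through π, arity by arity (`exists_lift`). Followed by the retraction onto F(M'), the lift is a
homology isomorphism between minimal free operads. Such a map is bijective
(`bijective_of_isHomologyIso`): differentials are decomposable, and bijectivity on decomposables is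
inherited from lower arities. -/

theorem neg_one_zpow_congr {k : Type u} [Field k] {a b : ℤ} (h : Even (a - b)) :
    (-1 : k) ^ a = (-1 : k) ^ b := by
  rw [show a = (a - b) + b by ring, zpow_add₀ (neg_ne_zero.2 one_ne_zero), h.neg_one_zpow, one_mul]

/-! ### Morphisms of symmetric sequences and of operads -/

/-- Morphisms of symmetric sequences. -/
structure SymmSeqHom {k : Type u} [Field k] (A : SymmSeq.{u, v₁} k) (B : SymmSeq.{u, v₂} k) where
  toFun : ∀ n p, A.obj n p →ₗ[k] B.obj n p
  map_act : ∀ {n p} (σ : Equiv.Perm (Fin n)) (x : A.obj n p),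
    toFun n p (A.act n p σ x) = B.act n p σ (toFun n p x)

namespace SymmSeqHom

variable {k : Type u} [Field k] {A : SymmSeq.{u, v₁} k} {B : SymmSeq.{u, v₂} k}
  {C : SymmSeq.{u, v₃} k}

/-- Composition of morphisms. -/
def comp (g : SymmSeqHom B C) (f : SymmSeqHom A B) : SymmSeqHom A C where
  toFun n p := (g.toFun n p).comp (f.toFun n p)
  map_act σ x := by simp [f.map_act, g.map_act]

end SymmSeqHom

namespace OperadHom

variable {k : Type u} [Field k] {P : NonunitalOperad.{u, v₁} k} {Q : NonunitalOperad.{u, v₂} k}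
  {R : NonunitalOperad.{u, v₃} k}

/-- The underlying morphism of symmetric sequences. -/
def toSymmSeqHom (φ : OperadHom P Q) : SymmSeqHom P.toSymmSeq Q.toSymmSeq where
  toFun := φ.toFun
  map_act := φ.map_act

/-- Composition of homomorphisms. -/
def comp (ψ : OperadHom Q R) (φ : OperadHom P Q) : OperadHom P R where
  toFun n p := (ψ.toFun n p).comp (φ.toFun n p)
  map_act σ x := by simp [φ.map_act, ψ.map_act]
  map_comp hn hp i f g := by simp [φ.map_comp, ψ.map_comp]

variable (P) in
/-- The identity homomorphism. -/
def id : OperadHom P P where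
  toFun _ _ := LinearMap.id
  map_act _ _ := rfl
  map_comp _ _ _ _ _ := rfl

end OperadHom

/-! ### Suboperads, dual numbers and derivations -/

namespace NonunitalOperad

variable {k : Type u} [Field k] (P : NonunitalOperad.{u, v} k)

/-- A family of subspaces which is stable under the operations of the operad. -/
structure IsSuboperad (C : ∀ n p, Submodule k (P.obj n p)) : Prop where
  act_mem : ∀ {n p} (σ : Equiv.Perm (Fin n)) {x : P.obj n p}, x ∈ C n p → P.act n p σ x ∈ C n p
  comp_mem : ∀ {m n r : ℕ} {p q s : ℤ} (hn : m + n = r + 1) (hp : p + q = s) (i : Fin n)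
    {f : P.obj m p} {g : P.obj n q}, f ∈ C m p → g ∈ C n q → P.comp hn hp i f g ∈ C r s

/-- The operad `P[ε]` with `ε² = 0`, where `ε` has degree `e`; the pair `(f, f')` stands
for `f + ε f'`. -/
def dualNumbers (e : ℤ) : NonunitalOperad.{u, v} k where
  obj n p := P.obj n p × P.obj n (p - e)
  act n p :=
    { toFun σ := (P.act n p σ).prodMap (P.act n (p - e) σ)
      map_one' := by ext <;> simp
      map_mul' σ τ := by ext <;> simp }
  subsingleton_obj_zero p :=
    have := P.subsingleton_obj_zero p
    have := P.subsingleton_obj_zero (p - e)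
    inferInstance
  comp {m n r p q s} hn hp i :=
    -- The sign in the last term comes from moving ε, of degree e, to the left past f.
    LinearMap.mk₂ k (fun f g => (P.comp hn hp i f.1 g.1,
      P.comp hn (by omega : p - e + q = s - e) i f.2 g.1 +
        (-1 : k) ^ (e * p) • P.comp hn (by omega : p + (q - e) = s - e) i f.1 g.2))
      (by intros; ext <;> simp; abel)
      (by intro c f g; ext <;> simp [smul_comm _ c])
      (by intros; ext <;> simp; abel)
      (by intro c f g; ext <;> simp [smul_comm _ c])
  comp_assoc {a b c ab bc abc p q r pq qr pqr} hab hbc hl hr hpq hqr hl' hr' i j i' hi f g h := by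
    ext
    · exact P.comp_assoc hab hbc hl hr hpq hqr hl' hr' i j i' hi f.1 g.1 h.1
    · simp only [LinearMap.mk₂_apply, map_add, map_smul, LinearMap.add_apply, LinearMap.smul_apply]
      rw [P.comp_assoc hab hbc hl hr (by omega : p - e + q = pq - e) hqr (by omega) (by omega)
          i j i' hi f.2 g.1 h.1,
        P.comp_assoc hab hbc hl hr (by omega : p + (q - e) = pq - e)
          (by omega : q - e + r = qr - e) (by omega) (by omega) i j i' hi f.1 g.2 h.1,
        P.comp_assoc hab hbc hl hr hpq
          (by omega : q + (r - e) = qr - e) (by omega) (by omega) i j i' hi f.1 g.1 h.2]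
      have hsign : (-1 : k) ^ (e * pq) = (-1) ^ (e * p) * (-1) ^ (e * q) := by
        rw [← hpq, mul_add, zpow_add₀ (neg_ne_zero.2 one_ne_zero)]
      simp only [hsign, smul_add, smul_smul, add_assoc]
  comp_comm {a b c ac bc abc p q r pr qr pqr} hac hbc hl hr hpr hqr hl' hr' i j hij i' hi' j' hj'
      f g h := by
    ext
    · exact P.comp_comm hac hbc hl hr hpr hqr hl' hr' i j hij i' hi' j' hj' f.1 g.1 h.1
    · simp only [LinearMap.mk₂_apply, map_add, map_smul, Prod.smul_snd]
      rw [P.comp_comm hac hbc hl hr (by omega : p - e + r = pr - e) hqr (by omega) (by omega)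
          i j hij i' hi' j' hj' f.2 g.1 h.1,
        P.comp_comm hac hbc hl hr hpr (by omega : q - e + r = qr - e) (by omega) (by omega)
          i j hij i' hi' j' hj' f.1 g.2 h.1,
        P.comp_comm hac hbc hl hr (by omega : p + (r - e) = pr - e)
          (by omega : q + (r - e) = qr - e) (by omega) (by omega)
          i j hij i' hi' j' hj' f.1 g.1 h.2]
      simp only [smul_add, smul_smul, ← zpow_add₀ (neg_ne_zero.2 (one_ne_zero (α := k)))]
      rw [neg_one_zpow_congr (k := k) (a := (p - e) * q) (b := p * q + e * q)
          ⟨-(e * q), by ring⟩,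
        neg_one_zpow_congr (k := k) (a := e * p + p * (q - e)) (b := p * q) ⟨0, by ring⟩,
        neg_one_zpow_congr (k := k) (a := e * p + (e * q + p * q))
          (b := p * q + (e * q + e * p)) ⟨0, by ring⟩]
      abel
  comp_act hn hp σ τ i f g := by
    ext
    · exact P.comp_act hn hp σ τ i f.1 g.1
    · simp [P.comp_act]

end NonunitalOperad

/-- A derivation of degree `-e` of an operad. -/
structure OperadDerivation {k : Type u} [Field k] (P : NonunitalOperad.{u, v} k) (e : ℤ) where
  toFun : ∀ (n : ℕ) {p q : ℤ}, q + e = p → (P.obj n p →ₗ[k] P.obj n q)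
  map_act : ∀ {n : ℕ} {p q : ℤ} (h : q + e = p) (σ : Equiv.Perm (Fin n)) (f : P.obj n p),
    toFun n h (P.act n p σ f) = P.act n q σ (toFun n h f)
  map_comp : ∀ {m n r : ℕ} {p q s p' q' s' : ℤ} (hn : m + n = r + 1) (hp : p + q = s)
    (hp' : p' + e = p) (hq' : q' + e = q) (hs' : s' + e = s)
    (h₁ : p' + q = s') (h₂ : p + q' = s') (i : Fin n) (f : P.obj m p) (g : P.obj n q),
    toFun r hs' (P.comp hn hp i f g) =
      P.comp hn h₁ i (toFun m hp' f) g + (-1 : k) ^ (e * p) • P.comp hn h₂ i f (toFun n hq' g)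

/-! ### Free operads: universal property, decomposable elements, derivations -/

namespace FreeOperad

variable {k : Type u} [Field k] {M : OperadCollection.{u, v} k}

/-- Evaluation of an expression in an operad. -/
def Term.eval {P : NonunitalOperad.{u, v₁} k} (f : SymmSeqHom M.toSymmSeq P.toSymmSeq) :
    ∀ {n : ℕ} {p : ℤ}, Term M n p → P.obj n p
  | _, _, .gen x => f.toFun _ _ x
  | _, _, .zero => 0
  | _, _, .add s t => s.eval f + t.eval f
  | _, _, .smul c t => c • t.eval f
  | _, _, .act σ t => P.act _ _ σ (t.eval f)
  | _, _, .comp hn hp i s t => P.comp hn hp i (s.eval f) (t.eval f)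

theorem Rel.eval_eq {P : NonunitalOperad.{u, v₁} k} (f : SymmSeqHom M.toSymmSeq P.toSymmSeq)
    {n : ℕ} {p : ℤ} {s t : Term M n p} (h : Rel M s t) : s.eval f = t.eval f := by
  induction h with
  | refl t => rfl
  | symm _ ih => exact ih.symm
  | trans _ _ ih ih' => exact ih.trans ih'
  | add _ _ ih ih' => simp only [Term.eval, ih, ih']
  | smul c _ ih => simp only [Term.eval, ih]
  | act σ _ ih => simp only [Term.eval, ih]
  | comp hn hp i _ _ ih ih' => simp only [Term.eval, ih, ih']
  | comp_assoc hab hbc hl hr hpq hqr hl' hr' i j i' hi f g h =>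
    exact P.comp_assoc hab hbc hl hr hpq hqr hl' hr' i j i' hi _ _ _
  | comp_comm hac hbc hl hr hpr hqr hl' hr' i j hij i' hi' j' hj' f g h =>
    exact P.comp_comm hac hbc hl hr hpr hqr hl' hr' i j hij i' hi' j' hj' _ _ _
  | comp_act hn hp σ τ i => exact P.comp_act hn hp σ τ i _ _
  | add_comm => exact _root_.add_comm _ _
  | add_assoc => exact _root_.add_assoc _ _ _
  | add_smul => exact _root_.add_smul _ _ _
  | mul_smul => exact SemigroupAction.mul_smul _ _ _
  | _ => simp [Term.eval, f.map_act]

/-- The universal property of the free operad. -/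
def lift {P : NonunitalOperad.{u, v₁} k} (f : SymmSeqHom M.toSymmSeq P.toSymmSeq) :
    OperadHom (freeOperad M) P where
  toFun n p :=
    { toFun := Quotient.lift (Term.eval f) fun _ _ h => Rel.eval_eq f h
      map_add' := by rintro ⟨x⟩ ⟨y⟩; rfl
      map_smul' := by rintro c ⟨x⟩; rfl }
  map_act := by rintro n p σ ⟨x⟩; rfl
  map_comp := by rintro m n r p q s hn hp i ⟨x⟩ ⟨y⟩; rfl

/-- The inclusion of the generators. -/
def gen (M : OperadCollection.{u, v} k) (n : ℕ) (p : ℤ) : M.obj n p →ₗ[k] (freeOperad M).obj n p :=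
  ι M n p

@[simp]
theorem lift_gen {P : NonunitalOperad.{u, v₁} k} (f : SymmSeqHom M.toSymmSeq P.toSymmSeq) {n : ℕ}
    {p : ℤ} (x : M.obj n p) : (lift f).toFun n p (gen M n p x) = f.toFun n p x := rfl

theorem gen_act {n : ℕ} {p : ℤ} (σ : Equiv.Perm (Fin n)) (x : M.obj n p) :
    gen M n p (M.act n p σ x) = (freeOperad M).act n p σ (gen M n p x) :=
  mk_eq (Rel.gen_act σ x)

variable (M) in
/-- The inclusion of the generators as a morphism of symmetric sequences. -/
def genHom : SymmSeqHom M.toSymmSeq (freeOperad M).toSymmSeq where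
  toFun := gen M
  map_act := gen_act

@[simp]
theorem genHom_toFun {n : ℕ} {p : ℤ} (x : M.obj n p) : (genHom M).toFun n p x = gen M n p x := rfl

theorem obj_induction {C : ∀ (n : ℕ) (p : ℤ), (freeOperad M).obj n p → Prop}
    (gen : ∀ n p x, C n p (gen M n p x)) (zero : ∀ n p, C n p 0)
    (add : ∀ n p x y, C n p x → C n p y → C n p (x + y))
    (smul : ∀ n p (c : k) x, C n p x → C n p (c • x))
    (act : ∀ n p σ x, C n p x → C n p ((freeOperad M).act n p σ x))
    (comp : ∀ {m n r : ℕ} {p q s : ℤ} (hn : m + n = r + 1) (hp : p + q = s) (i : Fin n) f g,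
      C m p f → C n q g → C r s ((freeOperad M).comp hn hp i f g))
    {n : ℕ} {p : ℤ} (x : (freeOperad M).obj n p) : C n p x := by
  obtain ⟨t, rfl⟩ := mk_surjective x
  induction t with
  | gen x => exact gen _ _ x
  | zero => exact zero _ _
  | add s t hs ht => exact add _ _ _ _ hs ht
  | smul c t ht => exact smul _ _ c _ ht
  | act σ t ht => exact act _ _ σ _ ht
  | comp hn hp i f g hf hg => exact comp hn hp i _ _ hf hg

/-- In a composition of arity < 2 the inserted factor f has arity < 2 as well, so the vanishing
descends to the generators. This is what makes induction on the arity possible. -/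
theorem eq_zero_of_lt_two {n : ℕ} {p : ℤ} (hn : n < 2) (x : (freeOperad M).obj n p) : x = 0 := by
  induction x using obj_induction with
  | gen n p x =>
    have := M.subsingleton_obj n p hn
    rw [Subsingleton.elim x 0, map_zero]
  | zero => rfl
  | add n p x y hx hy => rw [hx hn, hy hn, add_zero]
  | smul n p c x hx => rw [hx hn, smul_zero]
  | act n p σ x hx => rw [hx hn, map_zero]
  | comp h hp i f g hf hg => rw [hf (by have := i.2; omega), map_zero, LinearMap.zero_apply]

/-- The span of the elements obtained from compositions of elements of smaller arity. -/
def decomposables (M : OperadCollection.{u, v} k) (n : ℕ) (p : ℤ) :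
    Submodule k ((freeOperad M).obj n p) :=
  Submodule.span k {x | ∃ (m l : ℕ) (q s : ℤ) (hn : m + l = n + 1) (hp : q + s = p) (i : Fin l)
    (f : (freeOperad M).obj m q) (g : (freeOperad M).obj l s) (σ : Equiv.Perm (Fin n)),
    m < n ∧ l < n ∧ x = (freeOperad M).act n p σ ((freeOperad M).comp hn hp i f g)}

theorem act_mem_decomposables {n : ℕ} {p : ℤ} (σ : Equiv.Perm (Fin n))
    {x : (freeOperad M).obj n p} (hx : x ∈ decomposables M n p) :
    (freeOperad M).act n p σ x ∈ decomposables M n p := by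
  induction hx using Submodule.span_induction with
  | mem x hx =>
    obtain ⟨m, l, q, s, hn, hp, i, f, g, τ, hm, hl, rfl⟩ := hx
    refine Submodule.subset_span ⟨m, l, q, s, hn, hp, i, f, g, σ * τ, hm, hl, ?_⟩
    simp
  | zero => simp
  | add x y _ _ hx hy => rw [map_add]; exact add_mem hx hy
  | smul c x _ hx => rw [map_smul]; exact Submodule.smul_mem _ _ hx

/-- A factor of arity < 2 is zero; otherwise both arities are ≥ 2, and m + n = r + 1 forces both to
be < r. -/
theorem comp_mem_decomposables {m n r : ℕ} {p q s : ℤ} (hn : m + n = r + 1) (hp : p + q = s)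
    (i : Fin n) (f : (freeOperad M).obj m p) (g : (freeOperad M).obj n q) :
    (freeOperad M).comp hn hp i f g ∈ decomposables M r s := by
  by_cases hm : m < 2
  · rw [eq_zero_of_lt_two hm f, map_zero, LinearMap.zero_apply]
    exact zero_mem _
  by_cases hn' : n < 2
  · rw [eq_zero_of_lt_two hn' g, map_zero]
    exact zero_mem _
  exact Submodule.subset_span ⟨m, n, p, q, hn, hp, i, f, g, 1, by omega, by omega, by simp⟩

theorem mem_range_gen_sup_decomposables {n : ℕ} {p : ℤ} (x : (freeOperad M).obj n p) :
    x ∈ LinearMap.range (gen M n p) ⊔ decomposables M n p := by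
  induction x using obj_induction with
  | gen n p x => exact Submodule.mem_sup_left ⟨x, rfl⟩
  | zero => exact zero_mem _
  | add n p x y hx hy => exact add_mem hx hy
  | smul n p c x hx => exact Submodule.smul_mem _ c hx
  | act n p σ x hx =>
    obtain ⟨_, ⟨x, rfl⟩, y, hy, rfl⟩ := Submodule.mem_sup.1 hx
    rw [map_add, ← gen_act]
    exact add_mem (Submodule.mem_sup_left ⟨_, rfl⟩)
      (Submodule.mem_sup_right (act_mem_decomposables σ hy))
  | comp hn hp i f g _ _ =>
    exact Submodule.mem_sup_right (comp_mem_decomposables hn hp i f g)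

theorem exists_eq_gen_add {n : ℕ} {p : ℤ} (x : (freeOperad M).obj n p) :
    ∃ (y : M.obj n p), ∃ z ∈ decomposables M n p, x = gen M n p y + z := by
  obtain ⟨_, ⟨y, rfl⟩, z, hz, h⟩ := Submodule.mem_sup.1 (mem_range_gen_sup_decomposables x)
  exact ⟨y, z, hz, h.symm⟩

section Suboperad

variable {C : ∀ n p, Submodule k ((freeOperad M).obj n p)}

/-- A suboperad which contains the generators of arity `≤ N` contains all elements of
arity `≤ N`. -/
theorem mem_suboperad_of_le (hC : (freeOperad M).IsSuboperad C) (N : ℕ)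
    (hgen : ∀ n ≤ N, ∀ p x, gen M n p x ∈ C n p) {n : ℕ} {p : ℤ} (hn : n ≤ N)
    (x : (freeOperad M).obj n p) : x ∈ C n p := by
  induction x using obj_induction with
  | gen n p x => exact hgen _ hn _ _
  | zero => exact zero_mem _
  | add n p x y hx hy => exact add_mem (hx hn) (hy hn)
  | smul n p c x hx => exact Submodule.smul_mem _ c (hx hn)
  | act n p σ x hx => exact hC.act_mem σ (hx hn)
  | @comp m n r p q s h hp i f g hf hg =>
    by_cases hm : m < 2
    · rw [eq_zero_of_lt_two hm f, map_zero, LinearMap.zero_apply]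
      exact zero_mem _
    · have := i.2
      exact hC.comp_mem h hp i (hf (by omega)) (hg (by omega))

theorem mem_suboperad (hC : (freeOperad M).IsSuboperad C)
    (hgen : ∀ n p x, gen M n p x ∈ C n p) {n : ℕ} {p : ℤ}
    (x : (freeOperad M).obj n p) : x ∈ C n p :=
  mem_suboperad_of_le hC n (fun _ _ => hgen _) le_rfl x

/-- A suboperad which contains all elements of arity `< n` contains the decomposable elements of
arity `n`. -/
theorem decomposables_le (hC : (freeOperad M).IsSuboperad C) {n : ℕ} {p : ℤ}
    (h : ∀ m < n, ∀ q, C m q = ⊤) : decomposables M n p ≤ C n p := by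
  refine Submodule.span_le.2 ?_
  rintro _ ⟨m, l, q, s, hn, hp, i, f, g, σ, hm, hl, rfl⟩
  exact hC.act_mem σ (hC.comp_mem hn hp i (h m hm q ▸ trivial) (h l hl s ▸ trivial))

end Suboperad

theorem isSuboperad_eqLocus {P : NonunitalOperad.{u, v₁} k} {Q : NonunitalOperad.{u, v₂} k}
    (φ ψ : OperadHom P Q) :
    P.IsSuboperad fun n p => LinearMap.eqLocus (φ.toFun n p) (ψ.toFun n p) where
  act_mem σ x hx := by
    simp only [LinearMap.mem_eqLocus] at hx ⊢
    rw [φ.map_act, ψ.map_act, hx]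
  comp_mem hn hp i f g hf hg := by
    simp only [LinearMap.mem_eqLocus] at hf hg ⊢
    rw [φ.map_comp, ψ.map_comp, hf, hg]

theorem hom_eq_of_le {P : NonunitalOperad.{u, v₁} k} {φ ψ : OperadHom (freeOperad M) P} (N : ℕ)
    (h : ∀ n ≤ N, ∀ p x, φ.toFun n p (gen M n p x) = ψ.toFun n p (gen M n p x)) {n : ℕ} {p : ℤ}
    (hn : n ≤ N) (x : (freeOperad M).obj n p) : φ.toFun n p x = ψ.toFun n p x :=
  mem_suboperad_of_le (isSuboperad_eqLocus φ ψ) N h hn x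

theorem hom_eq {P : NonunitalOperad.{u, v₁} k} {φ ψ : OperadHom (freeOperad M) P}
    (h : ∀ n p x, φ.toFun n p (gen M n p x) = ψ.toFun n p (gen M n p x)) {n : ℕ} {p : ℤ}
    (x : (freeOperad M).obj n p) : φ.toFun n p x = ψ.toFun n p x :=
  hom_eq_of_le n (fun _ _ => h _) le_rfl x

/-- Allows a homomorphism to be changed on generators of arity n without affecting its values on
decomposables of arity n. -/
theorem hom_eq_of_mem_decomposables {P : NonunitalOperad.{u, v₁} k}
    {φ ψ : OperadHom (freeOperad M) P} {n : ℕ}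
    (h : ∀ m < n, ∀ p x, φ.toFun m p x = ψ.toFun m p x) {p : ℤ}
    {x : (freeOperad M).obj n p} (hx : x ∈ decomposables M n p) : φ.toFun n p x = ψ.toFun n p x :=
  decomposables_le (isSuboperad_eqLocus φ ψ)
    (fun m hm q => Submodule.eq_top_iff'.2 fun x => h m hm q x) hx

/-- A morphism of collections induces a homomorphism of free operads. -/
def map {M' : OperadCollection.{u, w} k} (f : SymmSeqHom M.toSymmSeq M'.toSymmSeq) :
    OperadHom (freeOperad M) (freeOperad M') :=
  lift ((genHom M').comp f)

@[simp]
theorem map_gen {M' : OperadCollection.{u, w} k} (f : SymmSeqHom M.toSymmSeq M'.toSymmSeq)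
    {n : ℕ} {p : ℤ} (x : M.obj n p) :
    (map f).toFun n p (gen M n p x) = gen M' n p (f.toFun n p x) := rfl

theorem map_map_of_le {M' : OperadCollection.{u, w} k} (f : SymmSeqHom M.toSymmSeq M'.toSymmSeq)
    (g : SymmSeqHom M'.toSymmSeq M.toSymmSeq) (N : ℕ)
    (h : ∀ n ≤ N, ∀ p x, g.toFun n p (f.toFun n p x) = x) {n : ℕ} {p : ℤ} (hn : n ≤ N)
    (x : (freeOperad M).obj n p) : (map g).toFun n p ((map f).toFun n p x) = x :=
  hom_eq_of_le (φ := (map g).comp (map f)) (ψ := OperadHom.id _) N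
    (fun n hn p x => congrArg (gen M n p) (h n hn p x)) hn x

theorem IsWord.mem_decomposables {l n : ℕ} {p : ℤ} {x : (freeOperad M).obj n p} (h : IsWord l x)
    (hl : 2 ≤ l) : x ∈ decomposables M n p := by
  induction h with
  | gen x => omega
  | act σ _ ih => exact act_mem_decomposables σ (ih hl)
  | comp hn hp i _ _ _ _ => exact comp_mem_decomposables hn hp i _ _

theorem IsWord.one_le {l n : ℕ} {p : ℤ} {x : (freeOperad M).obj n p} (h : IsWord l x) :
    1 ≤ l := by
  induction h with
  | gen x => exact le_rfl
  | act _ _ ih => exact ih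
  | comp _ _ _ _ _ ih _ => omega

/-- Words span: their span is closed under all operations and contains the generators. Needed to
expand the factors of a decomposable element into words. -/
theorem lengthGE_one (n : ℕ) (p : ℤ) : lengthGE M 1 n p = ⊤ := by
  have hword : ∀ {l n : ℕ} {p : ℤ} {x : (freeOperad M).obj n p}, IsWord l x →
      x ∈ ⨆ j ≥ 1, lengthPart M j n p := fun {l n p x} hx =>
    Submodule.mem_iSup_of_mem l (Submodule.mem_iSup_of_mem hx.one_le (Submodule.subset_span hx))
  have hspan : ∀ (n : ℕ) (p : ℤ), lengthGE M 1 n p =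
      Submodule.span k {x : (freeOperad M).obj n p | ∃ l, IsWord l x} := by
    intro n p
    refine le_antisymm (iSup₂_le fun j _ => Submodule.span_mono fun x hx => ⟨j, hx⟩) ?_
    refine Submodule.span_le.2 ?_
    rintro x ⟨l, hx⟩
    exact hword hx
  refine Submodule.eq_top_iff'.2 fun x => ?_
  suffices hC : (freeOperad M).IsSuboperad (fun n p => lengthGE M 1 n p) by
    exact mem_suboperad hC (fun n p x => hword (IsWord.gen x)) x
  constructor
  · intro n p σ x hx
    rw [hspan] at hx ⊢
    refine (Submodule.span_le (p := Submodule.comap ((freeOperad M).act n p σ)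
      (Submodule.span k _))).2 ?_ hx
    rintro x ⟨l, hx⟩
    exact Submodule.subset_span ⟨l, hx.act σ⟩
  · intro m n r p q s hn hp i f g hf hg
    rw [hspan] at hf hg ⊢
    have := Submodule.apply_mem_map₂ ((freeOperad M).comp hn hp i) hf hg
    rw [Submodule.map₂_span_span] at this
    refine Submodule.span_mono ?_ this
    rintro _ ⟨f, ⟨l, hf⟩, g, ⟨l', hg⟩, rfl⟩
    exact ⟨l + l', hf.comp hn hp i hg⟩

/-- Translates the minimality condition into one about arities: a word of length ≥ 2 involves a
composition, and conversely the two factors of a composition are sums of words of length ≥ 1. -/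
theorem lengthGE_two (n : ℕ) (p : ℤ) : lengthGE M 2 n p = decomposables M n p := by
  refine le_antisymm ?_ ?_
  · exact iSup₂_le fun j hj => Submodule.span_le.2 fun x hx => IsWord.mem_decomposables hx hj
  · refine Submodule.span_le.2 ?_
    rintro _ ⟨m, l, q, s, hn, hp, i, f, g, σ, hm, hl, rfl⟩
    have hmem : ∀ {j n : ℕ} {p : ℤ} {x : (freeOperad M).obj n p}, 2 ≤ j → IsWord j x →
        x ∈ lengthGE M 2 n p := fun {j n p x} hj hx =>
      Submodule.mem_iSup_of_mem j (Submodule.mem_iSup_of_mem hj (Submodule.subset_span hx))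
    have hspan : ∀ {n : ℕ} {p : ℤ} (x : (freeOperad M).obj n p),
        x ∈ Submodule.span k {x : (freeOperad M).obj n p | ∃ l, IsWord l x} := fun {n p} x => by
      have hx : x ∈ lengthGE M 1 n p := lengthGE_one (M := M) n p ▸ trivial
      have hle : lengthGE M 1 n p ≤
          Submodule.span k {x : (freeOperad M).obj n p | ∃ l, IsWord l x} :=
        iSup₂_le fun j _ => Submodule.span_mono fun x hx => ⟨j, hx⟩
      exact hle hx
    have := Submodule.mem_map_of_mem (f := (freeOperad M).act n p σ)
      (Submodule.apply_mem_map₂ ((freeOperad M).comp hn hp i) (hspan f) (hspan g))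
    rw [Submodule.map₂_span_span, Submodule.map_span] at this
    refine Submodule.span_le.2 ?_ this
    rintro _ ⟨_, ⟨f, ⟨l, hf⟩, g, ⟨l', hg⟩, rfl⟩, rfl⟩
    exact hmem (by have := hf.one_le; have := hg.one_le; omega) ((hf.comp hn hp i hg).act σ)

/-- Derivations of a free operad may be prescribed on the generators. -/
theorem exists_derivation (e : ℤ)
    (δ : ∀ (n : ℕ) {p q : ℤ}, q + e = p → (M.obj n p →ₗ[k] (freeOperad M).obj n q))
    (hδ : ∀ (n : ℕ) {p q : ℤ} (h : q + e = p) (σ : Equiv.Perm (Fin n)) (x : M.obj n p),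
      δ n h (M.act n p σ x) = (freeOperad M).act n q σ (δ n h x)) :
    ∃ Δ : OperadDerivation (freeOperad M) e, ∀ (n : ℕ) {p q : ℤ} (h : q + e = p) (x : M.obj n p),
      Δ.toFun n h (gen M n p x) = δ n h x := by
  -- A derivation Δ is the same as a homomorphism x ↦ x + ε Δ x into the dual numbers, and freeness
  -- provides the latter.
  let φ : OperadHom (freeOperad M) ((freeOperad M).dualNumbers e) :=
    lift { toFun := fun n p => (gen M n p).prod (δ n (sub_add_cancel p e))
           map_act := fun {n p} σ x => Prod.ext (gen_act σ x) (hδ n (sub_add_cancel p e) σ x) }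
  let fst : OperadHom ((freeOperad M).dualNumbers e) (freeOperad M) :=
    { toFun := fun _ _ => LinearMap.fst k _ _
      map_act := fun _ _ => rfl
      map_comp := fun _ _ _ _ _ => rfl }
  have hφ : ∀ {n p} (x : (freeOperad M).obj n p), (φ.toFun n p x).1 = x := fun x =>
    hom_eq (φ := fst.comp φ) (ψ := OperadHom.id _) (fun _ _ _ => rfl) x
  -- The second component lives in degree p - e; it is transported to every q with q + e = p.
  obtain ⟨Δ, hΔ⟩ : ∃ Δ : ∀ (n : ℕ) {p q : ℤ}, q + e = p →
      ((freeOperad M).obj n p →ₗ[k] (freeOperad M).obj n q),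
      ∀ (n : ℕ) {p : ℤ} (h : p - e + e = p) (x : (freeOperad M).obj n p),
        Δ n h x = (φ.toFun n p x).2 :=
    ⟨fun n p q h => (eq_sub_of_add_eq h) ▸ ((LinearMap.snd k ((freeOperad M).obj n p)
      ((freeOperad M).obj n (p - e))).comp (φ.toFun n p)), fun _ _ _ _ => rfl⟩
  refine ⟨⟨Δ, ?_, ?_⟩, ?_⟩
  · intro n p q h σ f
    obtain rfl := eq_sub_of_add_eq h
    rw [hΔ, hΔ, φ.map_act]
    rfl
  · intro m n r p q s p' q' s' hn hp hp' hq' hs' h₁ h₂ i f g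
    obtain rfl := eq_sub_of_add_eq hp'
    obtain rfl := eq_sub_of_add_eq hq'
    obtain rfl := eq_sub_of_add_eq hs'
    rw [hΔ, hΔ, hΔ, φ.map_comp]
    change (freeOperad M).comp hn _ i _ (φ.toFun n q g).1 +
      (-1 : k) ^ (e * p) • (freeOperad M).comp hn _ i (φ.toFun m p f).1 _ = _
    rw [hφ, hφ]
  · intro n p q h x
    obtain rfl := eq_sub_of_add_eq h
    rw [hΔ]
    rfl

end FreeOperad

/-! ### Homology isomorphisms, elementwise and arity by arity -/

namespace OperadDifferential

variable {k : Type u} [Field k] {P : NonunitalOperad.{u, v} k} (D : OperadDifferential P)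

theorem d_comp_mem {m n r : ℕ} {p q s : ℤ} (C : Submodule k (P.obj r (s - 1)))
    (hn : m + n = r + 1) (hp : p + q = s) (i : Fin n) (f : P.obj m p) (g : P.obj n q)
    (hf : P.comp hn (by omega) i (D.d m (sub_add_cancel p 1) f) g ∈ C)
    (hg : P.comp hn (by omega) i f (D.d n (sub_add_cancel q 1) g) ∈ C) :
    D.d r (sub_add_cancel s 1) (P.comp hn hp i f g) ∈ C := by
  rw [D.d_comp hn hp (sub_add_cancel p 1) (sub_add_cancel q 1) (sub_add_cancel s 1)
    (by omega) (by omega)]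
  exact add_mem hf (Submodule.smul_mem _ _ hg)

end OperadDifferential

namespace DGOperadHom

variable {k : Type u} [Field k] {P : NonunitalOperad.{u, v₁} k} {Q : NonunitalOperad.{u, v₂} k}
  {R : NonunitalOperad.{u, v₃} k} {D : OperadDifferential P} {E : OperadDifferential Q}
  {G : OperadDifferential R}

/-- Composition of homomorphisms of dg operads. -/
def comp (ψ : DGOperadHom E G) (φ : DGOperadHom D E) : DGOperadHom D G where
  toOperadHom := ψ.toOperadHom.comp φ.toOperadHom
  map_d h f := (congrArg _ (φ.map_d h f)).trans (ψ.map_d h _)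

theorem homologyMap_comp (ψ : DGOperadHom E G) (φ : DGOperadHom D E) (n : ℕ) (p : ℤ) :
    ⇑((ψ.comp φ).homologyMap n p) = ψ.homologyMap n p ∘ φ.homologyMap n p := by
  funext x
  obtain ⟨x, rfl⟩ := Submodule.Quotient.mk_surjective _ x
  rfl

theorem IsHomologyIso.comp {ψ : DGOperadHom E G} {φ : DGOperadHom D E} (hψ : ψ.IsHomologyIso)
    (hφ : φ.IsHomologyIso) : (ψ.comp φ).IsHomologyIso := fun n p => by
  rw [homologyMap_comp]
  exact (hψ n p).comp (hφ n p)

theorem IsHomologyIso.of_comp_left {ψ : DGOperadHom E G} {φ : DGOperadHom D E}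
    (h : (ψ.comp φ).IsHomologyIso) (hψ : ψ.IsHomologyIso) : φ.IsHomologyIso := fun n p => by
  have := h n p
  rw [homologyMap_comp] at this
  exact (Function.Bijective.of_comp_iff' (hψ n p) _).1 this

theorem IsHomologyIso.of_comp_right {ψ : DGOperadHom E G} {φ : DGOperadHom D E}
    (h : (ψ.comp φ).IsHomologyIso) (hφ : φ.IsHomologyIso) : ψ.IsHomologyIso := fun n p => by
  have := h n p
  rw [homologyMap_comp] at this
  exact (Function.Bijective.of_comp_iff _ (hφ n p)).1 this

theorem IsHomologyIso.congr {φ ψ : DGOperadHom D E} (hφ : φ.IsHomologyIso)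
    (h : ∀ n p x, φ.toFun n p x = ψ.toFun n p x) : ψ.IsHomologyIso := by
  obtain ⟨⟨f, _, _⟩, _⟩ := φ
  obtain ⟨⟨g, _, _⟩, _⟩ := ψ
  obtain rfl : f = g := by
    funext n p
    exact LinearMap.ext (h n p)
  exact hφ

/-- In arity `n`, the homomorphism is injective in homology. -/
def HomologyInjectiveAt (φ : DGOperadHom D E) (n : ℕ) : Prop :=
  ∀ {p q r : ℤ} (h : q + 1 = p) (h' : p + 1 = r) (x : P.obj n p) (y : Q.obj n r),
    D.d n h x = 0 → φ.toFun n p x = E.d n h' y → ∃ z, D.d n h' z = x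

/-- In arity `n`, the homomorphism is surjective in homology. -/
def HomologySurjectiveAt (φ : DGOperadHom D E) (n : ℕ) : Prop :=
  ∀ {p q r : ℤ} (h : q + 1 = p) (h' : p + 1 = r) (y : Q.obj n p),
    E.d n h y = 0 → ∃ (x : P.obj n p) (z : Q.obj n r),
      D.d n h x = 0 ∧ φ.toFun n p x + E.d n h' z = y

/-- Replaces quotients by elements; the degrees p, q, r are independent variables, which avoids
transport along p - 1 + 1 = p. -/
theorem injective_homologyMap_iff (φ : DGOperadHom D E) (n : ℕ) :
    (∀ p, Function.Injective (φ.homologyMap n p)) ↔ φ.HomologyInjectiveAt n := by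
  constructor
  · intro H p q r h h' x y hx hxy
    obtain rfl := eq_sub_of_add_eq h
    subst h'
    have : Submodule.Quotient.mk (p := (D.boundaries n p).submoduleOf (D.cycles n p)) ⟨x, hx⟩ = 0 := by
      refine H p ?_
      rw [map_zero]
      exact (Submodule.Quotient.mk_eq_zero _).2 ⟨y, hxy.symm⟩
    exact (Submodule.Quotient.mk_eq_zero _).1 this
  · intro H p
    rw [injective_iff_map_eq_zero]
    intro a ha
    obtain ⟨⟨x, hx⟩, rfl⟩ := Submodule.Quotient.mk_surjective _ a
    obtain ⟨y, hy⟩ := (Submodule.Quotient.mk_eq_zero _).1 ha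
    exact (Submodule.Quotient.mk_eq_zero _).2 (H _ rfl x y hx hy.symm)

theorem surjective_homologyMap_iff (φ : DGOperadHom D E) (n : ℕ) :
    (∀ p, Function.Surjective (φ.homologyMap n p)) ↔ φ.HomologySurjectiveAt n := by
  constructor
  · intro H p q r h h' y hy
    obtain rfl := eq_sub_of_add_eq h
    subst h'
    obtain ⟨a, ha⟩ := H p (Submodule.Quotient.mk ⟨y, hy⟩)
    obtain ⟨⟨x, hx⟩, rfl⟩ := Submodule.Quotient.mk_surjective _ a
    obtain ⟨z, hz⟩ := (Submodule.Quotient.eq _).1 ha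
    refine ⟨x, -z, hx, ?_⟩
    have hz' : E.d n rfl z = φ.toFun n p x - y := hz
    rw [map_neg, hz']
    abel
  · intro H p a
    obtain ⟨⟨y, hy⟩, rfl⟩ := Submodule.Quotient.mk_surjective _ a
    obtain ⟨x, z, hx, hz⟩ := H _ rfl y hy
    refine ⟨Submodule.Quotient.mk ⟨x, hx⟩, (Submodule.Quotient.eq _).2 ⟨-z, ?_⟩⟩
    rw [map_neg]
    change _ = φ.toFun n p x - y
    rw [← hz]
    abel

theorem isHomologyIso_iff (φ : DGOperadHom D E) :
    φ.IsHomologyIso ↔ ∀ n, φ.HomologyInjectiveAt n ∧ φ.HomologySurjectiveAt n := by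
  simp only [← injective_homologyMap_iff, ← surjective_homologyMap_iff]
  exact ⟨fun h n => ⟨fun p => (h n p).1, fun p => (h n p).2⟩,
    fun h n p => ⟨(h n).1 p, (h n).2 p⟩⟩

end DGOperadHom

/-! ### Differentials on free operads -/

namespace FreeOperad

/-- Both φ d and d φ obey the same Leibniz rule along φ, so compatibility with the differentials
need only be checked on generators. -/
theorem isSuboperad_commute {k : Type u} [Field k] {P : NonunitalOperad.{u, v₁} k}
    {Q : NonunitalOperad.{u, v₂} k} (D : OperadDifferential P) (E : OperadDifferential Q)
    (φ : OperadHom P Q) :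
    P.IsSuboperad fun n p => LinearMap.eqLocus
      ((φ.toFun n (p - 1)).comp (D.d n (sub_add_cancel p 1)))
      ((E.d n (sub_add_cancel p 1)).comp (φ.toFun n p)) where
  act_mem σ x hx := by
    simp only [LinearMap.mem_eqLocus, LinearMap.comp_apply] at hx ⊢
    rw [D.d_act, φ.map_act, φ.map_act, E.d_act, hx]
  comp_mem {m n r p q s} hn hp i f g hf hg := by
    simp only [LinearMap.mem_eqLocus, LinearMap.comp_apply] at hf hg ⊢
    rw [φ.map_comp, D.d_comp hn hp (sub_add_cancel p 1) (sub_add_cancel q 1) (sub_add_cancel s 1)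
      (by omega) (by omega), E.d_comp hn hp (sub_add_cancel p 1) (sub_add_cancel q 1)
      (sub_add_cancel s 1) (by omega) (by omega), map_add, map_smul, φ.map_comp, φ.map_comp, hf, hg]

variable {k : Type u} [Field k] {M : OperadCollection.{u, v} k} {Q : NonunitalOperad.{u, w} k}

theorem map_d_of_le (D : OperadDifferential (freeOperad M)) (E : OperadDifferential Q)
    (φ : OperadHom (freeOperad M) Q) (N : ℕ)
    (H : ∀ n ≤ N, ∀ {p q : ℤ} (h : q + 1 = p) (x : M.obj n p),
      φ.toFun n q (D.d n h (gen M n p x)) = E.d n h (φ.toFun n p (gen M n p x)))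
    {n : ℕ} (hn : n ≤ N) {p q : ℤ} (h : q + 1 = p) (x : (freeOperad M).obj n p) :
    φ.toFun n q (D.d n h x) = E.d n h (φ.toFun n p x) := by
  obtain rfl := eq_sub_of_add_eq h
  exact mem_suboperad_of_le (isSuboperad_commute D E φ) N (fun n hn p x => H n hn _ x) hn x

theorem map_d_of_gen (D : OperadDifferential (freeOperad M)) (E : OperadDifferential Q)
    (φ : OperadHom (freeOperad M) Q)
    (H : ∀ (n : ℕ) {p q : ℤ} (h : q + 1 = p) (x : M.obj n p),
      φ.toFun n q (D.d n h (gen M n p x)) = E.d n h (φ.toFun n p (gen M n p x)))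
    {n : ℕ} {p q : ℤ} (h : q + 1 = p) (x : (freeOperad M).obj n p) :
    φ.toFun n q (D.d n h x) = E.d n h (φ.toFun n p x) :=
  map_d_of_le D E φ n (fun n _ => H n) le_rfl h x

theorem map_d_of_mem_decomposables (D : OperadDifferential (freeOperad M))
    (E : OperadDifferential Q) (φ : OperadHom (freeOperad M) Q) {n : ℕ}
    (H : ∀ m < n, ∀ {p q : ℤ} (h : q + 1 = p) (x : (freeOperad M).obj m p),
      φ.toFun m q (D.d m h x) = E.d m h (φ.toFun m p x))
    {p q : ℤ} (h : q + 1 = p) {x : (freeOperad M).obj n p} (hx : x ∈ decomposables M n p) :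
    φ.toFun n q (D.d n h x) = E.d n h (φ.toFun n p x) := by
  obtain rfl := eq_sub_of_add_eq h
  exact decomposables_le (isSuboperad_commute D E φ)
    (fun m hm q => Submodule.eq_top_iff'.2 fun x => H m hm _ x) hx

/-- A homomorphism out of a free operad commutes with derivations if it does on the generators. -/
theorem derivation_map_of_gen (D : OperadDifferential (freeOperad M)) (Δ : OperadDerivation Q 1)
    (φ : OperadHom (freeOperad M) Q)
    (H : ∀ (n : ℕ) {p q : ℤ} (h : q + 1 = p) (x : M.obj n p),
      Δ.toFun n h (φ.toFun n p (gen M n p x)) = φ.toFun n q (D.d n h (gen M n p x)))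
    {n : ℕ} {p q : ℤ} (h : q + 1 = p) (x : (freeOperad M).obj n p) :
    Δ.toFun n h (φ.toFun n p x) = φ.toFun n q (D.d n h x) := by
  obtain rfl := eq_sub_of_add_eq h
  refine mem_suboperad (C := fun n p => LinearMap.eqLocus
    (Δ.toFun n (sub_add_cancel p 1) ∘ₗ φ.toFun n p)
    (φ.toFun n _ ∘ₗ D.d n (sub_add_cancel p 1))) ⟨?_, ?_⟩ (fun n p x => H n _ x) x
  · intro n p σ x hx
    simp only [LinearMap.mem_eqLocus, LinearMap.comp_apply] at hx ⊢
    rw [φ.map_act, Δ.map_act, hx, D.d_act, φ.map_act]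
  · intro m n r p q s hn hp i f g hf hg
    simp only [LinearMap.mem_eqLocus, LinearMap.comp_apply] at hf hg ⊢
    rw [φ.map_comp, D.d_comp hn hp (sub_add_cancel p 1) (sub_add_cancel q 1)
        (sub_add_cancel s 1) (by omega) (by omega),
      Δ.map_comp hn hp (sub_add_cancel p 1) (sub_add_cancel q 1)
        (sub_add_cancel s 1) (by omega) (by omega), hf, hg, map_add, map_smul,
      φ.map_comp, φ.map_comp, one_mul]

/-- A differential on a free operad may be prescribed on the generators. -/
theorem exists_differential
    (δ : ∀ (n : ℕ) {p q : ℤ}, q + 1 = p → (M.obj n p →ₗ[k] (freeOperad M).obj n q))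
    (hδ : ∀ (n : ℕ) {p q : ℤ} (h : q + 1 = p) (σ : Equiv.Perm (Fin n)) (x : M.obj n p),
      δ n h (M.act n p σ x) = (freeOperad M).act n q σ (δ n h x))
    (hδδ : ∀ Δ : OperadDerivation (freeOperad M) 1,
      (∀ (n : ℕ) {p q : ℤ} (h : q + 1 = p) (x : M.obj n p),
        Δ.toFun n h (gen M n p x) = δ n h x) →
      ∀ (n : ℕ) {p q r : ℤ} (h : q + 1 = p) (h' : r + 1 = q) (x : M.obj n p),
        Δ.toFun n h' (δ n h x) = 0) :
    ∃ D : OperadDifferential (freeOperad M), ∀ (n : ℕ) {p q : ℤ} (h : q + 1 = p) (x : M.obj n p),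
      D.d n h (gen M n p x) = δ n h x := by
  obtain ⟨Δ, hΔ⟩ := exists_derivation 1 δ hδ
  have hC : (freeOperad M).IsSuboperad fun n p => LinearMap.ker
      ((Δ.toFun n (sub_add_cancel (p - 1) 1)).comp (Δ.toFun n (sub_add_cancel p 1))) := by
    constructor
    · intro n p σ x hx
      simp only [LinearMap.mem_ker, LinearMap.comp_apply] at hx ⊢
      rw [Δ.map_act, Δ.map_act, hx, map_zero]
    · intro m n r p q s hn hp i f g hf hg
      simp only [LinearMap.mem_ker, LinearMap.comp_apply] at hf hg ⊢
      rw [Δ.map_comp hn hp (sub_add_cancel p 1) (sub_add_cancel q 1) (sub_add_cancel s 1)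
          (by omega) (by omega), map_add, map_smul,
        Δ.map_comp hn _ (sub_add_cancel (p - 1) 1) (sub_add_cancel q 1)
          (sub_add_cancel (s - 1) 1) (by omega) (by omega),
        Δ.map_comp hn _ (sub_add_cancel p 1) (sub_add_cancel (q - 1) 1)
          (sub_add_cancel (s - 1) 1) (by omega) (by omega), hf, hg]
      -- The two mixed terms d f ∘ d g in d² carry the signs (-1)^p and (-1)^(p - 1), and cancel.
      have h1 : (-1 : k) ^ p = - (-1) ^ (p - 1) := by
        rw [zpow_sub_one₀ (neg_ne_zero.2 one_ne_zero)]
        simp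
      simp [h1]
  refine ⟨⟨fun n p q h => Δ.toFun n h, fun h σ f => Δ.map_act h σ f, ?_, ?_⟩, hΔ⟩
  · intro m n r p q s p' q' s' hn hp hp' hq' hs' h₁ h₂ i f g
    rw [Δ.map_comp hn hp hp' hq' hs' h₁ h₂, one_mul]
  · intro n p q r h h' f
    obtain rfl := eq_sub_of_add_eq h
    obtain rfl := eq_sub_of_add_eq h'
    exact mem_suboperad hC (fun n p x => by
      rw [LinearMap.mem_ker, LinearMap.comp_apply, hΔ]
      exact hδδ Δ hΔ n _ _ x) f

theorem isMinimal_iff {D : OperadDifferential (freeOperad M)} :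
    IsMinimal D ↔ ∀ (n : ℕ) {p q : ℤ} (h : q + 1 = p) (x : M.obj n p),
      D.d n h (gen M n p x) ∈ decomposables M n q := by
  simp only [← lengthGE_two]
  rfl

/-- If the differential is minimal, then the differential of every element is decomposable. -/
theorem IsMinimal.d_mem_decomposables {D : OperadDifferential (freeOperad M)} (hD : IsMinimal D)
    {n : ℕ} {p q : ℤ} (h : q + 1 = p) (x : (freeOperad M).obj n p) :
    D.d n h x ∈ decomposables M n q := by
  obtain rfl := eq_sub_of_add_eq h
  refine mem_suboperad (C := fun n p =>
    (decomposables M n (p - 1)).comap (D.d n (sub_add_cancel p 1))) ⟨?_, ?_⟩ ?_ x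
  · intro n p σ x hx
    rw [Submodule.mem_comap] at hx ⊢
    rw [D.d_act]
    exact act_mem_decomposables σ hx
  · intro m n r p q s hn hp i f g hf hg
    rw [Submodule.mem_comap]
    apply D.d_comp_mem
    · exact comp_mem_decomposables hn _ i _ g
    · exact comp_mem_decomposables hn _ i f _
  · intro n p x
    exact isMinimal_iff.1 hD n (sub_add_cancel p 1) x

end FreeOperad

/-! ### Averaging over a finite group -/

namespace Representation

variable {k : Type u} [Field k] {G : Type*} [Group G] [Fintype G]
  {V W U : Type*} [AddCommGroup V] [Module k V] [AddCommGroup W] [Module k W]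
  [AddCommGroup U] [Module k U]
  (ρ : Representation k G V) (τ : Representation k G W)

/-- The average of a linear map over a finite group. -/
noncomputable def average (f : V →ₗ[k] W) : V →ₗ[k] W :=
  (Fintype.card G : k)⁻¹ • ∑ g, τ g ∘ₗ f ∘ₗ ρ g⁻¹

theorem average_apply (f : V →ₗ[k] W) (v : V) :
    average ρ τ f v = (Fintype.card G : k)⁻¹ • ∑ g, τ g (f (ρ g⁻¹ v)) := by
  simp [average]

theorem average_act (f : V →ₗ[k] W) (g : G) (v : V) :
    average ρ τ f (ρ g v) = τ g (average ρ τ f v) := by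
  simp only [average_apply, map_smul, map_sum]
  congr 1
  refine Fintype.sum_equiv (Equiv.mulLeft g⁻¹) _ _ fun x => ?_
  simp only [Equiv.coe_mulLeft, ← Module.End.mul_apply, ← map_mul]
  simp

/-- Every summand of the average has the same image u, and the group order is invertible in
characteristic zero. -/
theorem map_average_eq [CharZero k] (f : V →ₗ[k] W) (p : W →ₗ[k] U) {v : V} {u : U}
    (h : ∀ g, p (τ g (f (ρ g⁻¹ v))) = u) : p (average ρ τ f v) = u := by
  have : (Fintype.card G : k) ≠ 0 := Nat.cast_ne_zero.2 Fintype.card_ne_zero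
  rw [average_apply, map_smul, map_sum, Finset.sum_congr rfl fun g _ => h g, Finset.sum_const,
    Finset.card_univ, ← Nat.cast_smul_eq_nsmul k, smul_smul, inv_mul_cancel₀ this, one_smul]

/-- Equivariant linear maps can be lifted. -/
theorem exists_equivariant_lift [CharZero k] (π : G → U → U) (p : W →ₗ[k] U) (hp : ∀ g w, p (τ g w) = π g (p w))
    (f : V →ₗ[k] U) (hf : ∀ g v, f (ρ g v) = π g (f v))
    (hfp : ∀ v, f v ∈ LinearMap.range p) :
    ∃ F : V →ₗ[k] W, (∀ g v, F (ρ g v) = τ g (F v)) ∧ ∀ v, p (F v) = f v := by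
  -- A linear section of p over its range gives a lift that need not be equivariant; averaging it
  -- keeps the equation p ∘ F = f.
  obtain ⟨s, hs⟩ := p.rangeRestrict.exists_rightInverse_of_surjective p.range_rangeRestrict
  have hs' : ∀ x : LinearMap.range p, p (s x) = x := fun x =>
    congrArg Subtype.val (LinearMap.congr_fun hs x)
  refine ⟨average ρ τ (s ∘ₗ f.codRestrict _ hfp), average_act ρ τ _, fun v => ?_⟩
  refine map_average_eq ρ τ _ p fun g => ?_
  rw [hp, LinearMap.comp_apply, hs', LinearMap.codRestrict_apply, ← hf, ← Module.End.mul_apply,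
    ← map_mul]
  simp

/-- Maschke's theorem. -/
theorem exists_stable_complement [CharZero k] (B Z : Submodule k V) (hBZ : B ≤ Z)
    (hB : ∀ g, ∀ v ∈ B, ρ g v ∈ B) (hZ : ∀ g, ∀ v ∈ Z, ρ g v ∈ Z) :
    ∃ N : Submodule k V, (∀ g, ∀ v ∈ N, ρ g v ∈ N) ∧ N ≤ Z ∧ N ⊓ B = ⊥ ∧ Z ≤ N ⊔ B := by
  obtain ⟨f, hf⟩ := LinearMap.exists_leftInverse_of_injective B.subtype B.ker_subtype
  have hf' : ∀ b ∈ B, (f b : V) = b := fun b hb =>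
    congrArg Subtype.val (LinearMap.congr_fun hf ⟨b, hb⟩)
  -- F is an equivariant projection onto B; its kernel within Z is the complement.
  set F := average ρ ρ (B.subtype ∘ₗ f) with hF
  have hFB : ∀ b ∈ B, F b = b := fun b hb => by
    refine map_average_eq ρ ρ _ LinearMap.id fun g => ?_
    simp only [LinearMap.id_apply, LinearMap.comp_apply, Submodule.subtype_apply]
    rw [hf' _ (hB _ _ hb), ← Module.End.mul_apply, ← map_mul]
    simp
  have hFmem : ∀ v, F v ∈ B := fun v => by
    rw [hF, average_apply]
    exact B.smul_mem _ (B.sum_mem fun g _ => hB g _ (f _).2)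
  refine ⟨Z ⊓ LinearMap.ker F, ?_, inf_le_left, ?_, ?_⟩
  · rintro g v ⟨hv, hv'⟩
    refine ⟨hZ g v hv, ?_⟩
    rw [SetLike.mem_coe, LinearMap.mem_ker] at hv' ⊢
    rw [hF, average_act, ← hF, hv', map_zero]
  · rw [eq_bot_iff]
    rintro v ⟨⟨_, hv⟩, hvB⟩
    rw [SetLike.mem_coe, LinearMap.mem_ker, hFB v hvB] at hv
    exact hv
  · intro v hv
    rw [← sub_add_cancel v (F v)]
    refine add_mem (Submodule.mem_sup_left ⟨sub_mem hv (hBZ (hFmem v)), ?_⟩)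
      (Submodule.mem_sup_right (hFmem v))
    rw [SetLike.mem_coe, LinearMap.mem_ker, map_sub, hFB _ (hFmem v), sub_self]

end Representation

/-! ### Homology isomorphisms between minimal free operads are bijective -/

namespace FreeOperad

variable {k : Type u} [Field k] {M : OperadCollection.{u, v} k} {M' : OperadCollection.{u, w} k}

/-- Decomposables of arity n are sums of compositions of factors of arity < n, and these factors can
be lifted separately. -/
theorem exists_decomposable_preimage (φ : OperadHom (freeOperad M) (freeOperad M')) {n : ℕ}
    (hφ : ∀ m < n, ∀ p, Function.Surjective (φ.toFun m p)) {p : ℤ}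
    {y : (freeOperad M').obj n p} (hy : y ∈ decomposables M' n p) :
    ∃ x ∈ decomposables M n p, φ.toFun n p x = y := by
  induction hy using Submodule.span_induction with
  | mem y hy =>
    obtain ⟨m, l, q, s, hn, hp, i, f, g, σ, hm, hl, rfl⟩ := hy
    obtain ⟨f, rfl⟩ := hφ m hm q f
    obtain ⟨g, rfl⟩ := hφ l hl s g
    refine ⟨(freeOperad M).act n p σ ((freeOperad M).comp hn hp i f g),
      act_mem_decomposables σ (comp_mem_decomposables hn hp i f g), ?_⟩
    rw [φ.map_act, φ.map_comp]
  | zero => exact ⟨0, zero_mem _, map_zero _⟩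
  | add y z _ _ hy hz =>
    obtain ⟨y, hy, rfl⟩ := hy
    obtain ⟨z, hz, rfl⟩ := hz
    exact ⟨y + z, add_mem hy hz, map_add _ _ _⟩
  | smul c y _ hy =>
    obtain ⟨y, hy, rfl⟩ := hy
    exact ⟨c • y, Submodule.smul_mem _ _ hy, map_smul _ _ _⟩

/-- Since F(M') is free, the inverse of φ on generators of arity ≤ n, extended by zero above,
defines a homomorphism ψ. Then ψ φ is the identity in arities ≤ n, hence on decomposables of arity n
+ 1. -/
theorem eq_zero_of_mem_decomposables (φ : OperadHom (freeOperad M) (freeOperad M')) {n : ℕ}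
    (hφ : ∀ m ≤ n, ∀ p, Function.Bijective (φ.toFun m p)) {p : ℤ}
    {x : (freeOperad M).obj (n + 1) p} (hx : x ∈ decomposables M (n + 1) p)
    (hx0 : φ.toFun (n + 1) p x = 0) : x = 0 := by
  classical
  let ψ : OperadHom (freeOperad M') (freeOperad M) := lift
    { toFun m p := if h : m ≤ n then
        (LinearEquiv.ofBijective (φ.toFun m p) (hφ m h p)).symm.toLinearMap ∘ₗ gen M' m p else 0
      map_act := by
        intro m p σ x
        by_cases h : m ≤ n
        · simp only [h, dif_pos, LinearMap.comp_apply]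
          change (LinearEquiv.ofBijective (φ.toFun m p) (hφ m h p)).symm (gen M' m p _) =
            (freeOperad M).act m p σ
              ((LinearEquiv.ofBijective (φ.toFun m p) (hφ m h p)).symm (gen M' m p x))
          rw [LinearEquiv.symm_apply_eq, LinearEquiv.ofBijective_apply, φ.map_act, gen_act]
          congr 1
          exact ((LinearEquiv.ofBijective (φ.toFun m p) (hφ m h p)).apply_symm_apply _).symm
        · simp [h] }
  have hψ : ∀ m ≤ n, ∀ p (y : (freeOperad M').obj m p), φ.toFun m p (ψ.toFun m p y) = y := by
    intro m hm p y
    refine hom_eq_of_le (φ := φ.comp ψ) (ψ := OperadHom.id _) n (fun m hm p y => ?_) hm y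
    change φ.toFun m p (ψ.toFun m p (gen M' m p y)) = gen M' m p y
    simp only [ψ, lift_gen, hm, dif_pos]
    exact (LinearEquiv.ofBijective (φ.toFun m p) (hφ m hm p)).apply_symm_apply _
  have hψ' := hom_eq_of_mem_decomposables (φ := ψ.comp φ) (ψ := OperadHom.id _)
    (fun m hm p x => (hφ m (Nat.lt_succ_iff.1 hm) p).1
      (hψ m (Nat.lt_succ_iff.1 hm) p (φ.toFun m p x))) hx
  change ψ.toFun _ _ (φ.toFun _ _ x) = x at hψ'
  rw [← hψ', hx0, map_zero]

/-- A homology isomorphism of free operads with minimal differentials is bijective. -/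
theorem bijective_of_isHomologyIso {D : OperadDifferential (freeOperad M)}
    {D' : OperadDifferential (freeOperad M')} (hD : IsMinimal D) (hD' : IsMinimal D')
    (φ : DGOperadHom D D') (hφ : φ.IsHomologyIso) (n : ℕ) :
    ∀ p, Function.Bijective (φ.toFun n p) := by
  rw [DGOperadHom.isHomologyIso_iff] at hφ
  induction n using Nat.strong_induction_on with
  | _ n ih =>
  obtain _ | n := n
  · intro p
    exact ⟨fun x y _ => (eq_zero_of_lt_two (by omega) x).trans
      (eq_zero_of_lt_two (by omega) y).symm, fun y => ⟨0, by
        rw [map_zero, eq_zero_of_lt_two (by omega) y]⟩⟩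
  have hinj : ∀ {p} {x : (freeOperad M).obj (n + 1) p}, x ∈ decomposables M (n + 1) p →
      φ.toFun (n + 1) p x = 0 → x = 0 := fun hx hx0 =>
    eq_zero_of_mem_decomposables φ.toOperadHom (fun m hm => ih m (Nat.lt_succ_iff.2 hm)) hx hx0
  have hsurj : ∀ {p} {y : (freeOperad M').obj (n + 1) p}, y ∈ decomposables M' (n + 1) p →
      ∃ x ∈ decomposables M (n + 1) p, φ.toFun (n + 1) p x = y := fun hy =>
    exists_decomposable_preimage φ.toOperadHom (fun m hm p => (ih m hm p).2) hy
  obtain ⟨hH, hH'⟩ := hφ (n + 1)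
  intro p
  constructor
  · rw [injective_iff_map_eq_zero]
    intro x hx
    -- A kernel element x is a cycle because d x is decomposable and killed by φ. Injectivity in
    -- homology makes x a boundary, hence decomposable, hence zero.
    have hdx : D.d (n + 1) (sub_add_cancel p 1) x = 0 :=
      hinj (hD.d_mem_decomposables _ x) (by rw [φ.map_d, hx, map_zero])
    obtain ⟨z, rfl⟩ := hH (sub_add_cancel p 1) rfl x 0 hdx (by rw [hx, map_zero])
    exact hinj (hD.d_mem_decomposables _ z) hx
  · intro y
    -- Lift d y to a decomposable c. It is a cycle with φ c = d y, so c = d z. Then y - φ z is a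
    -- cycle, equal to φ x up to a boundary, and boundaries, being decomposable, also lift.
    obtain ⟨c, hc, hcy⟩ := hsurj (hD'.d_mem_decomposables (sub_add_cancel p 1) y)
    have hdc : D.d (n + 1) (sub_add_cancel (p - 1) 1) c = 0 :=
      hinj (hD.d_mem_decomposables _ c) (by rw [φ.map_d, hcy, D'.d_d])
    obtain ⟨z, rfl⟩ := hH (sub_add_cancel (p - 1) 1) (sub_add_cancel p 1) c y hdc hcy
    obtain ⟨x, t, hx, hxt⟩ := hH' (sub_add_cancel p 1) rfl (y - φ.toFun (n + 1) p z)
      (by rw [map_sub, ← φ.map_d, hcy, sub_self])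
    obtain ⟨b, -, hb⟩ := hsurj (hD'.d_mem_decomposables (rfl : p + 1 = p + 1) t)
    exact ⟨x + b + z, by rw [map_add, map_add, hb, hxt, sub_add_cancel]⟩

/-- A bijective homomorphism of dg operads is an isomorphism. -/
noncomputable def _root_.DGOperadHom.isoOfBijective {P : NonunitalOperad.{u, v₁} k}
    {Q : NonunitalOperad.{u, v₂} k} {D : OperadDifferential P} {E : OperadDifferential Q}
    (φ : DGOperadHom D E) (hφ : ∀ n p, Function.Bijective (φ.toFun n p)) : DGOperadIso D E :=
  let e n p := LinearEquiv.ofBijective (φ.toFun n p) (hφ n p)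
  have he : ∀ n p x, φ.toFun n p ((e n p).symm x) = x := fun n p x => (e n p).apply_symm_apply x
  { hom := φ
    inv :=
      { toFun n p := (e n p).symm.toLinearMap
        map_act {n p} σ f := (hφ n p).1 (by
          simp only [LinearEquiv.coe_coe]
          rw [φ.map_act, he, he])
        map_comp {m n r p q s} hn hp i f g := (hφ r s).1 (by
          simp only [LinearEquiv.coe_coe]
          rw [φ.map_comp, he, he, he])
        map_d {n p q} h f := (hφ n q).1 (by
          simp only [LinearEquiv.coe_coe]
          rw [φ.map_d, he, he]) }
    hom_inv n p f := (e n p).symm_apply_apply f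
    inv_hom n p g := he n p g }

end FreeOperad

/-! ### Lifting through surjective homology isomorphisms -/

namespace FreeOperad

variable {k : Type u} [Field k] {M : OperadCollection.{u, v} k}
  {P : NonunitalOperad.{u, v₁} k} {S : NonunitalOperad.{u, v₂} k}

/-- The obstruction to extending a lift over one generator vanishes: c = d z by injectivity in
homology, and the cycle π z - s is corrected by surjectivity in homology together with surjectivity
of π. -/
theorem _root_.DGOperadHom.exists_preimage {E : OperadDifferential P} {G : OperadDifferential S}
    (π : DGOperadHom E G) {n : ℕ} (hπ : ∀ p, Function.Surjective (π.toFun n p))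
    (hinj : π.HomologyInjectiveAt n) (hsurj : π.HomologySurjectiveAt n) {p q r : ℤ}
    (h : q + 1 = p) (h' : r + 1 = q) (c : P.obj n q) (s : S.obj n p) (hc : E.d n h' c = 0)
    (hcs : π.toFun n q c = G.d n h s) :
    ∃ y, E.d n h y = c ∧ π.toFun n p y = s := by
  obtain ⟨z, rfl⟩ := hinj h' h c s hc hcs
  obtain ⟨x, t, hx, hxt⟩ := hsurj h rfl (π.toFun n p z - s)
    (by rw [map_sub, ← π.map_d, hcs, sub_self])
  obtain ⟨t, rfl⟩ := hπ _ t
  refine ⟨z - x - E.d n rfl t, ?_, ?_⟩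
  · rw [map_sub, map_sub, hx, E.d_d, sub_zero, sub_zero]
  · rw [map_sub, map_sub, π.map_d, sub_sub, hxt, sub_sub_cancel]

section

variable {D : OperadDifferential (freeOperad M)} {E : OperadDifferential P}
  {G : OperadDifferential S} (π : DGOperadHom E G) (ν : DGOperadHom D G)

/-- The morphism on generators `f` defines a lift of `ν` through `π` in arities `≤ N`. -/
def IsLiftUpTo (N : ℕ) (f : SymmSeqHom M.toSymmSeq P.toSymmSeq) : Prop :=
  ∀ n ≤ N, ∀ {p q : ℤ} (h : q + 1 = p) (x : M.obj n p),
    (lift f).toFun n q (D.d n h (gen M n p x)) = E.d n h (f.toFun n p x) ∧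
      π.toFun n p (f.toFun n p x) = ν.toFun n p (gen M n p x)

variable {π ν}

/-- For a generator x of arity N + 1, minimality makes d x decomposable, so its image is already
determined. The image y of x must satisfy two linear conditions, on d y and on π y, which are solved
jointly and equivariantly. -/
theorem IsLiftUpTo.exists_succ [CharZero k] (hD : IsMinimal D) (hπ : π.IsHomologyIso)
    (hπ' : ∀ n p, Function.Surjective (π.toFun n p)) {N : ℕ}
    {f : SymmSeqHom M.toSymmSeq P.toSymmSeq} (hf : IsLiftUpTo π ν N f) :
    ∃ g : SymmSeqHom M.toSymmSeq P.toSymmSeq, IsLiftUpTo π ν (N + 1) g ∧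
      ∀ n ≤ N, ∀ p x, g.toFun n p x = f.toFun n p x := by
  obtain ⟨hinj, hsurj⟩ := (π.isHomologyIso_iff.1 hπ) (N + 1)
  have hlift : ∀ p, ∃ F : M.obj (N + 1) p →ₗ[k] P.obj (N + 1) p,
      (∀ σ x, F (M.act (N + 1) p σ x) = P.act (N + 1) p σ (F x)) ∧
      ∀ x, (E.d (N + 1) (sub_add_cancel p 1)).prod (π.toFun (N + 1) p) (F x) =
        ((lift f).toFun _ _ (D.d _ (sub_add_cancel p 1) (gen M _ p x)), ν.toFun _ p (gen M _ p x)) := by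
    intro p
    refine Representation.exists_equivariant_lift _ (P.act (N + 1) p)
      (fun σ u => (P.act _ _ σ u.1, S.act _ _ σ u.2)) _ ?_
      (((lift f).toFun _ _ ∘ₗ D.d _ (sub_add_cancel p 1) ∘ₗ gen M _ p).prod
        (ν.toFun _ p ∘ₗ gen M _ p)) ?_ ?_
    · intro σ y
      exact Prod.ext (E.d_act _ σ y) (π.map_act σ y)
    · intro σ x
      simp only [LinearMap.prod_apply, Function.prod_apply, LinearMap.comp_apply, gen_act, D.d_act,
        OperadHom.map_act]
    · intro x
      have hx := hD.d_mem_decomposables (sub_add_cancel p 1) (gen M (N + 1) p x)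
      -- The hypotheses of `exists_preimage` hold because on the decomposable element d x the map
      -- `lift f` already commutes with differentials and lifts ν.
      obtain ⟨y, hy, hy'⟩ := π.exists_preimage (hπ' _) hinj hsurj (sub_add_cancel p 1)
        (sub_add_cancel (p - 1) 1)
        ((lift f).toFun _ _ (D.d _ (sub_add_cancel p 1) (gen M _ p x)))
        (ν.toFun _ p (gen M _ p x))
        (by
          rw [← map_d_of_mem_decomposables D E (lift f) (fun m hm p q h x =>
            map_d_of_le D E (lift f) N (fun n hn _ _ h x => (hf n hn h x).1) (by omega) h x) _ hx,
            D.d_d, map_zero])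
        (by
          rw [← ν.map_d]
          exact hom_eq_of_mem_decomposables (φ := π.toOperadHom.comp (lift f))
            (ψ := ν.toOperadHom) (fun m hm p x => hom_eq_of_le N
              (fun n hn p x => (hf n hn (sub_add_cancel p 1) x).2) (by omega) x) hx)
      exact ⟨y, Prod.ext hy hy'⟩
  have hext : ∀ n p, ∃ F : M.obj n p →ₗ[k] P.obj n p,
      (∀ σ x, F (M.act n p σ x) = P.act n p σ (F x)) ∧ (n ≤ N → F = f.toFun n p) ∧
      (n = N + 1 → ∀ {q : ℤ} (h : q + 1 = p) x,
        (lift f).toFun n q (D.d n h (gen M n p x)) = E.d n h (F x) ∧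
          π.toFun n p (F x) = ν.toFun n p (gen M n p x)) := by
    intro n p
    by_cases hn : n = N + 1
    · subst hn
      obtain ⟨F, hF, hF'⟩ := hlift p
      refine ⟨F, hF, fun h => by omega, fun _ q h x => ?_⟩
      obtain rfl := eq_sub_of_add_eq h
      exact ⟨(congrArg Prod.fst (hF' x)).symm, congrArg Prod.snd (hF' x)⟩
    · exact ⟨f.toFun n p, f.map_act, fun _ => rfl, fun h => absurd h hn⟩
  choose g hg hgf hg' using hext
  let g' : SymmSeqHom M.toSymmSeq P.toSymmSeq := ⟨g, fun {n p} σ x => hg n p σ x⟩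
  have hgf' : ∀ n ≤ N, ∀ p x, g'.toFun n p x = f.toFun n p x := fun n hn p x =>
    LinearMap.congr_fun (hgf n p hn) x
  have hlift_eq : ∀ n ≤ N, ∀ p x, (lift g').toFun n p x = (lift f).toFun n p x :=
    fun n hn p x => hom_eq_of_le N hgf' hn x
  refine ⟨g', fun n hn p q h x => ?_, hgf'⟩
  obtain hn | rfl := Nat.le_succ_iff.1 hn
  · rw [hlift_eq n hn, hgf' n hn]
    exact hf n hn h x
  -- The new values in arity N + 1 do not change the image of the decomposable element d x.
  · rw [hom_eq_of_mem_decomposables (ψ := lift f) (fun m hm => hlift_eq m (by omega))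
      (hD.d_mem_decomposables h (gen M (N + 1) p x))]
    exact hg' (N + 1) p rfl h x

/-- Free operads with minimal differential have the lifting property with respect to surjective
homology isomorphisms. -/
theorem exists_lift [CharZero k] (hD : IsMinimal D) (hπ : π.IsHomologyIso)
    (hπ' : ∀ n p, Function.Surjective (π.toFun n p)) :
    ∃ φ : DGOperadHom D E, ∀ n p x, π.toFun n p (φ.toFun n p x) = ν.toFun n p x := by
  let f₀ : SymmSeqHom M.toSymmSeq P.toSymmSeq := ⟨fun _ _ => 0, fun _ _ => by simp⟩
  have hf₀ : IsLiftUpTo π ν 0 f₀ := by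
    intro n hn p q h x
    rw [eq_zero_of_lt_two (by omega) (gen M n p x)]
    simp [f₀]
  choose! step hstep hstep' using fun N f hf =>
    IsLiftUpTo.exists_succ (π := π) (ν := ν) (N := N) (f := f) hD hπ hπ' hf
  let g : ℕ → SymmSeqHom M.toSymmSeq P.toSymmSeq := fun n => Nat.rec f₀ step n
  have hg : ∀ n, IsLiftUpTo π ν n (g n) := fun n => by
    induction n with
    | zero => exact hf₀
    | succ n ih => exact hstep n _ ih
  have hg' : ∀ n N, n ≤ N → ∀ p x, (g N).toFun n p x = (g n).toFun n p x := by
    intro n N hN p x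
    induction N, hN using Nat.le_induction with
    | base => rfl
    | succ N hN ih => rw [← ih]; exact hstep' N _ (hg N) n hN p x
  -- The values in arity n are final from step n on, so the limit is taken along the diagonal.
  let F : SymmSeqHom M.toSymmSeq P.toSymmSeq :=
    ⟨fun n p => (g n).toFun n p, fun σ x => (g _).map_act σ x⟩
  have hF : ∀ n p x, (lift F).toFun n p x = (lift (g n)).toFun n p x := fun n p x =>
    hom_eq_of_le n (fun m hm p x => (hg' m n hm p x).symm) le_rfl x
  refine ⟨⟨lift F, fun h x => map_d_of_gen D E (lift F) (fun n p q h x => ?_) h x⟩, fun n p x =>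
    hom_eq (φ := π.toOperadHom.comp (lift F)) (ψ := ν.toOperadHom) (fun n p x => ?_) x⟩
  · rw [hF]
    exact (hg n n le_rfl h x).1
  · exact (hg n n le_rfl (sub_add_cancel p 1) x).2

end

end FreeOperad

/-! ### Direct sums of collections -/

namespace OperadCollection

variable {k : Type u} [Field k]

/-- The direct sum of two collections. -/
def prod (M : OperadCollection.{u, v} k) (W : OperadCollection.{u, w} k) :
    OperadCollection.{u, max v w} k where
  obj n p := M.obj n p × W.obj n p
  act n p :=
    { toFun σ := (M.act n p σ).prodMap (W.act n p σ)
      map_one' := by ext <;> simp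
      map_mul' σ τ := by ext <;> simp }
  subsingleton_obj n p hn :=
    have := M.subsingleton_obj n p hn
    have := W.subsingleton_obj n p hn
    inferInstance

variable (M : OperadCollection.{u, v} k) (W : OperadCollection.{u, w} k)

/-- The inclusion of the first summand. -/
def inl : SymmSeqHom M.toSymmSeq (M.prod W).toSymmSeq where
  toFun n p := LinearMap.inl k (M.obj n p) (W.obj n p)
  map_act σ _ := Prod.ext rfl (map_zero (W.act _ _ σ)).symm

/-- The inclusion of the second summand. -/
def inr : SymmSeqHom W.toSymmSeq (M.prod W).toSymmSeq where
  toFun n p := LinearMap.inr k (M.obj n p) (W.obj n p)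
  map_act σ _ := Prod.ext (map_zero (M.act _ _ σ)).symm rfl

/-- The projection to the first summand. -/
def fst : SymmSeqHom (M.prod W).toSymmSeq M.toSymmSeq where
  toFun n p := LinearMap.fst k (M.obj n p) (W.obj n p)
  map_act _ _ := rfl

/-- The projection to the second summand. -/
def snd : SymmSeqHom (M.prod W).toSymmSeq W.toSymmSeq where
  toFun n p := LinearMap.snd k (M.obj n p) (W.obj n p)
  map_act _ _ := rfl

variable {M W}

/-- The morphism out of a direct sum given by two morphisms. -/
def desc {C : SymmSeq.{u, v₁} k} (f : SymmSeqHom M.toSymmSeq C) (g : SymmSeqHom W.toSymmSeq C) :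
    SymmSeqHom (M.prod W).toSymmSeq C where
  toFun n p := f.toFun n p ∘ₗ (M.fst W).toFun n p + g.toFun n p ∘ₗ (M.snd W).toFun n p
  map_act σ x := by
    simp only [LinearMap.add_apply, LinearMap.comp_apply, map_add, SymmSeqHom.map_act]

@[simp]
theorem desc_toFun {C : SymmSeq.{u, v₁} k} (f : SymmSeqHom M.toSymmSeq C)
    (g : SymmSeqHom W.toSymmSeq C) {n : ℕ} {p : ℤ} (x : (M.prod W).obj n p) :
    (desc f g).toFun n p x =
      f.toFun n p ((M.fst W).toFun n p x) + g.toFun n p ((M.snd W).toFun n p x) := rfl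

theorem inl_fst_add_inr_snd {n : ℕ} {p : ℤ} (x : (M.prod W).obj n p) :
    (M.inl W).toFun n p ((M.fst W).toFun n p x) + (M.inr W).toFun n p ((M.snd W).toFun n p x) =
      x :=
  Prod.ext (add_zero x.1) (zero_add x.2)

@[simp]
theorem fst_inl {n : ℕ} {p : ℤ} (x : M.obj n p) :
    (M.fst W).toFun n p ((M.inl W).toFun n p x) = x := rfl

@[simp]
theorem snd_inl {n : ℕ} {p : ℤ} (x : M.obj n p) :
    (M.snd W).toFun n p ((M.inl W).toFun n p x) = 0 := rfl

@[simp]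
theorem fst_inr {n : ℕ} {p : ℤ} (x : W.obj n p) :
    (M.fst W).toFun n p ((M.inr W).toFun n p x) = 0 := rfl

@[simp]
theorem snd_inr {n : ℕ} {p : ℤ} (x : W.obj n p) :
    (M.snd W).toFun n p ((M.inr W).toFun n p x) = x := rfl

end OperadCollection

/-! ### Differentials on F(M ⊕ W) and anticommutators -/

namespace FreeOperad

open OperadCollection

variable {k : Type u} [Field k] {M : OperadCollection.{u, v} k} {W : OperadCollection.{u, w} k}

theorem map_fst_map_inl {n : ℕ} {p : ℤ} (x : (freeOperad M).obj n p) :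
    (map (M.fst W)).toFun n p ((map (M.inl W)).toFun n p x) = x :=
  map_map_of_le (M.inl W) (M.fst W) n (fun _ _ _ _ => rfl) le_rfl x

/-- A differential on `F(M)` may be extended to `F(M ⊕ W)` by prescribing it on `W`. -/
theorem exists_differential_prod (D : OperadDifferential (freeOperad M))
    (δ : ∀ (n : ℕ) {p q : ℤ}, q + 1 = p → (W.obj n p →ₗ[k] (freeOperad (M.prod W)).obj n q))
    (hδ : ∀ (n : ℕ) {p q : ℤ} (h : q + 1 = p) (σ : Equiv.Perm (Fin n)) (x : W.obj n p),
      δ n h (W.act n p σ x) = (freeOperad (M.prod W)).act n q σ (δ n h x))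
    (hδδ : ∀ Δ : OperadDerivation (freeOperad (M.prod W)) 1,
      (∀ (n : ℕ) {p q : ℤ} (h : q + 1 = p) (x : (freeOperad M).obj n p),
        Δ.toFun n h ((map (M.inl W)).toFun n p x) = (map (M.inl W)).toFun n q (D.d n h x)) →
      (∀ (n : ℕ) {p q : ℤ} (h : q + 1 = p) (x : W.obj n p),
        Δ.toFun n h (gen (M.prod W) n p ((M.inr W).toFun n p x)) = δ n h x) →
      ∀ (n : ℕ) {p q r : ℤ} (h : q + 1 = p) (h' : r + 1 = q) (x : W.obj n p),
        Δ.toFun n h' (δ n h x) = 0) :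
    ∃ D' : OperadDifferential (freeOperad (M.prod W)),
      (∀ (n : ℕ) {p q : ℤ} (h : q + 1 = p) (x : (freeOperad M).obj n p),
        D'.d n h ((map (M.inl W)).toFun n p x) = (map (M.inl W)).toFun n q (D.d n h x)) ∧
      (∀ (n : ℕ) {p q : ℤ} (h : q + 1 = p) (x : W.obj n p),
        D'.d n h (gen (M.prod W) n p ((M.inr W).toFun n p x)) = δ n h x) := by
  let δ' : ∀ (n : ℕ) {p q : ℤ}, q + 1 = p →
      ((M.prod W).obj n p →ₗ[k] (freeOperad (M.prod W)).obj n q) := fun n p q h =>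
    (map (M.inl W)).toFun n q ∘ₗ D.d n h ∘ₗ gen M n p ∘ₗ (M.fst W).toFun n p +
      δ n h ∘ₗ (M.snd W).toFun n p
  have hδ'_inl : ∀ (n : ℕ) {p q : ℤ} (h : q + 1 = p) (x : M.obj n p),
      δ' n h ((M.inl W).toFun n p x) = (map (M.inl W)).toFun n q (D.d n h (gen M n p x)) := by
    intro n p q h x
    simp [δ']
  have hδ'_inr : ∀ (n : ℕ) {p q : ℤ} (h : q + 1 = p) (x : W.obj n p),
      δ' n h ((M.inr W).toFun n p x) = δ n h x := by
    intro n p q h x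
    simp [δ']
  have hΔinl : ∀ Δ : OperadDerivation (freeOperad (M.prod W)) 1,
      (∀ (n : ℕ) {p q : ℤ} (h : q + 1 = p) (x : (M.prod W).obj n p),
        Δ.toFun n h (gen (M.prod W) n p x) = δ' n h x) →
      (∀ (n : ℕ) {p q : ℤ} (h : q + 1 = p) (x : (freeOperad M).obj n p),
        Δ.toFun n h ((map (M.inl W)).toFun n p x) = (map (M.inl W)).toFun n q (D.d n h x)) := by
    intro Δ hΔ n p q h x
    exact derivation_map_of_gen D Δ (map (M.inl W)) (fun n p q h x => by
      rw [map_gen, hΔ, hδ'_inl]) h x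
  obtain ⟨D', hD'⟩ := exists_differential δ' (by
    intro n p q h σ x
    simp only [δ', LinearMap.add_apply, LinearMap.comp_apply, map_add]
    rw [SymmSeqHom.map_act, SymmSeqHom.map_act, hδ, gen_act, D.d_act, OperadHom.map_act]) (by
    intro Δ hΔ n p q r h h' x
    rw [← inl_fst_add_inr_snd x, map_add, hδ'_inl, hδ'_inr, map_add, hΔinl Δ hΔ, D.d_d, map_zero,
      zero_add]
    exact hδδ Δ (hΔinl Δ hΔ) (fun n p q h x => by rw [hΔ, hδ'_inr]) n h h' _)
  refine ⟨D', ?_, fun n p q h x => by rw [hD', hδ'_inr]⟩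
  exact hΔinl ⟨fun n _ _ h => D'.d n h, fun h => D'.d_act h, fun hn hp hp' hq' hs' h₁ h₂ i f g => by
    rw [one_mul, D'.d_comp hn hp hp' hq' hs' h₁ h₂]⟩ hD'

/-- A homomorphism out of `F(M ⊕ W)` commutes with the differentials if it does on `F(M)` and
on `W`. -/
theorem map_d_prod {Q : NonunitalOperad.{u, v₁} k} {D : OperadDifferential (freeOperad M)}
    {D' : OperadDifferential (freeOperad (M.prod W))} {E : OperadDifferential Q}
    (hD' : ∀ (n : ℕ) {p q : ℤ} (h : q + 1 = p) (x : (freeOperad M).obj n p),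
      D'.d n h ((map (M.inl W)).toFun n p x) = (map (M.inl W)).toFun n q (D.d n h x))
    (ψ : OperadHom (freeOperad (M.prod W)) Q) (φ : DGOperadHom D E)
    (hψ : ∀ n p (x : M.obj n p), ψ.toFun n p (gen _ n p ((M.inl W).toFun n p x)) =
      φ.toFun n p (gen M n p x))
    (hψ' : ∀ (n : ℕ) {p q : ℤ} (h : q + 1 = p) (x : W.obj n p),
      ψ.toFun n q (D'.d n h (gen _ n p ((M.inr W).toFun n p x))) =
        E.d n h (ψ.toFun n p (gen _ n p ((M.inr W).toFun n p x))))
    {n : ℕ} {p q : ℤ} (h : q + 1 = p) (x : (freeOperad (M.prod W)).obj n p) :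
    ψ.toFun n q (D'.d n h x) = E.d n h (ψ.toFun n p x) := by
  have hφ : ∀ n p x, ψ.toFun n p ((map (M.inl W)).toFun n p x) = φ.toFun n p x := fun n p x =>
    hom_eq (φ := ψ.comp (map (M.inl W))) (ψ := φ.toOperadHom) hψ x
  refine map_d_of_gen D' E ψ (fun n p q h x => ?_) h x
  rw [← inl_fst_add_inr_snd x, map_add, map_add, map_add, map_add, map_add, hψ' n h, ← map_gen, hD', hφ, hφ,
    φ.map_d]

section Acyclic

variable {D' : OperadDifferential (freeOperad M)} {s : OperadDerivation (freeOperad M) (-1)}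

/-- The anticommutator of a differential and a derivation of degree `1`. -/
def anticommutator (D' : OperadDifferential (freeOperad M))
    (s : OperadDerivation (freeOperad M) (-1)) (n : ℕ) (p : ℤ) :
    (freeOperad M).obj n p →ₗ[k] (freeOperad M).obj n p :=
  D'.d n (rfl : p + 1 = p + 1) ∘ₗ s.toFun n (add_neg_cancel_right p 1) +
    s.toFun n (sub_eq_add_neg p 1).symm ∘ₗ D'.d n (sub_add_cancel p 1)

theorem anticommutator_act {n : ℕ} {p : ℤ} (σ : Equiv.Perm (Fin n))
    (x : (freeOperad M).obj n p) :
    anticommutator D' s n p ((freeOperad M).act n p σ x) =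
      (freeOperad M).act n p σ (anticommutator D' s n p x) := by
  simp [anticommutator, D'.d_act, s.map_act]

/-- The anticommutator of two derivations of odd degree is a derivation of degree 0: the mixed terms
cancel in pairs. -/
theorem anticommutator_comp {m n r : ℕ} {p q t : ℤ} (hn : m + n = r + 1) (hp : p + q = t)
    (i : Fin n) (f : (freeOperad M).obj m p) (g : (freeOperad M).obj n q) :
    anticommutator D' s r t ((freeOperad M).comp hn hp i f g) =
      (freeOperad M).comp hn hp i (anticommutator D' s m p f) g +
        (freeOperad M).comp hn hp i f (anticommutator D' s n q g) := by
  simp only [anticommutator, LinearMap.add_apply, LinearMap.comp_apply, map_add]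
  rw [s.map_comp hn hp (add_neg_cancel_right p 1) (add_neg_cancel_right q 1)
      (add_neg_cancel_right t 1) (by omega) (by omega),
    D'.d_comp hn hp (sub_add_cancel p 1) (sub_add_cancel q 1) (sub_add_cancel t 1)
      (by omega) (by omega), map_add, map_smul, map_add, map_smul,
    D'.d_comp hn _ rfl (sub_add_cancel q 1) rfl hp (by omega),
    D'.d_comp hn _ (sub_add_cancel p 1) rfl rfl (by omega) hp,
    s.map_comp hn _ (sub_eq_add_neg p 1).symm (add_neg_cancel_right q 1)
      (sub_eq_add_neg t 1).symm hp (by omega),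
    s.map_comp hn _ (add_neg_cancel_right p 1) (sub_eq_add_neg q 1).symm
      (sub_eq_add_neg t 1).symm (by omega) hp]
  have h1 : (-1 : k) ^ (-1 * p) = (-1) ^ p := neg_one_zpow_congr ⟨-p, by ring⟩
  have h2 : (-1 : k) ^ (p + 1) = -(-1) ^ p := by
    rw [zpow_add_one₀ (neg_ne_zero.2 one_ne_zero)]; simp
  have h3 : (-1 : k) ^ (-1 * (p - 1)) = -(-1) ^ p := by
    rw [← h2]; exact neg_one_zpow_congr ⟨-p, by ring⟩
  have h4 : (-1 : k) ^ p * (-1) ^ p = 1 := by rw [← mul_zpow]; simp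
  simp only [h1, h2, h3, smul_add, smul_smul, h4, one_smul, neg_smul]
  abel

/-- The anticommutator of `d` and `s` annihilates homology: a cycle in the span of eigenvectors with
nonzero eigenvalues is a boundary. -/
theorem exists_d_eq_of_mem_iSup [CharZero k] {n : ℕ} {p : ℤ} {z : (freeOperad M).obj n p}
    (hz : D'.d n (sub_add_cancel p 1) z = 0)
    (hz' : z ∈ ⨆ a : ℕ, LinearMap.eqLocus (anticommutator D' s n p)
      (((a : k) + 1) • LinearMap.id)) :
    ∃ t, D'.d n (rfl : p + 1 = p + 1) t = z := by
  set T : Module.End k ((freeOperad M).obj n p) := anticommutator D' s n p with hT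
  -- q is a product of factors X - (a + 1), whose constant terms are nonzero in characteristic zero.
  obtain ⟨q, hq, hqz⟩ : ∃ q : Polynomial k, q.eval 0 ≠ 0 ∧ Polynomial.aeval T q z = 0 := by
    clear hz
    induction hz' using Submodule.iSup_induction' with
    | mem a x hx =>
      rw [LinearMap.mem_eqLocus] at hx
      refine ⟨Polynomial.X - Polynomial.C ((a : k) + 1), ?_, ?_⟩
      · simp only [Polynomial.eval_sub, Polynomial.eval_X, Polynomial.eval_C, zero_sub, ne_eq,
          neg_eq_zero]
        exact_mod_cast a.succ_ne_zero
      · simp only [map_sub, Polynomial.aeval_X, Polynomial.aeval_C, LinearMap.sub_apply]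
        rw [hx, Module.algebraMap_end_apply]
        exact sub_self _
    | zero => exact ⟨1, by simp, by simp⟩
    | add x y _ _ hx hy =>
      obtain ⟨q, hq, hqx⟩ := hx
      obtain ⟨q', hq', hqy⟩ := hy
      refine ⟨q * q', by simp [hq, hq'], ?_⟩
      rw [map_add]
      nth_rw 1 [mul_comm q q']
      rw [map_mul, map_mul, Module.End.mul_apply, Module.End.mul_apply, hqx, hqy]
      simp
  set B := LinearMap.range (D'.d n (rfl : p + 1 = p + 1)) with hB
  have hTB : ∀ x ∈ B, T x ∈ B := by
    rintro _ ⟨t, rfl⟩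
    refine ⟨s.toFun n (add_neg_cancel_right p 1) (D'.d n rfl t), ?_⟩
    simp [hT, anticommutator, D'.d_d]
  have hqB : ∀ q : Polynomial k, ∀ x ∈ B, Polynomial.aeval T q x ∈ B := by
    intro q x hx
    induction q using Polynomial.induction_on' with
    | add q q' hq hq' => rw [map_add]; exact add_mem hq hq'
    | monomial j a =>
      rw [Polynomial.aeval_monomial, Module.End.mul_apply, Module.algebraMap_end_apply]
      exact B.smul_mem a (Module.End.pow_apply_mem_of_forall_mem j hTB x hx)
  have hTz : T z ∈ B := ⟨s.toFun n (add_neg_cancel_right p 1) z, by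
    simp [hT, anticommutator, hz]⟩
  -- Write q = X · divX + q(0). As T z is a boundary and boundaries are T-stable, q(T) z = 0
  -- exhibits q(0) z as a boundary.
  have hmem := hqB q.divX _ hTz
  rw [← Polynomial.divX_mul_X_add q, map_add, map_mul, Polynomial.aeval_X, Polynomial.aeval_C,
    LinearMap.add_apply, Module.End.mul_apply, Module.algebraMap_end_apply] at hqz
  rw [eq_neg_of_add_eq_zero_left hqz, neg_mem_iff] at hmem
  rw [← Polynomial.coeff_zero_eq_eval_zero] at hq
  exact (B.smul_mem_iff hq).1 hmem

end Acyclic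

end FreeOperad

/-! ### Contractible extensions, factorization and uniqueness -/

namespace FreeOperad

open OperadCollection

variable {k : Type u} [Field k] {M : OperadCollection.{u, v} k} {W : OperadCollection.{u, w} k}

/-- Used for the composite of an inclusion and its retraction, which is known to be the identity
only pointwise. -/
theorem _root_.DGOperadHom.isHomologyIso_of_eq_self {P : NonunitalOperad.{u, v} k}
    {D : OperadDifferential P} (φ : DGOperadHom D D) (hφ : ∀ n p x, φ.toFun n p x = x) :
    φ.IsHomologyIso :=
  φ.isHomologyIso_iff.2 fun n => ⟨fun _ _ x y _ hxy => ⟨y, by rw [← hxy, hφ]⟩,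
    fun _ _ y hy => ⟨y, 0, hy, by rw [hφ, map_zero, add_zero]⟩⟩

variable (M W) in
/-- The `a`-th term of the decomposition of `F(M ⊕ W)` by the number of factors in `W`,
seen as eigenspaces of an anticommutator `[D', s]`. -/
def weightPart (D' : OperadDifferential (freeOperad (M.prod W)))
    (s : OperadDerivation (freeOperad (M.prod W)) (-1)) :
    ℕ → ∀ n p, Submodule k ((freeOperad (M.prod W)).obj n p)
  -- Weight 0 is the image of F(M), not the eigenspace for 0, so that the weight 0 component of an
  -- element visibly comes from F(M).
  | 0, n, p => LinearMap.range ((map (M.inl W)).toFun n p)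
  | a + 1, n, p => LinearMap.eqLocus (anticommutator D' s n p) (((a : k) + 1) • LinearMap.id)

section

variable {D' : OperadDifferential (freeOperad (M.prod W))}
  {s : OperadDerivation (freeOperad (M.prod W)) (-1)}

theorem weightPart_act {a n : ℕ} {p : ℤ} (σ : Equiv.Perm (Fin n))
    {x : (freeOperad (M.prod W)).obj n p} (hx : x ∈ weightPart M W D' s a n p) :
    (freeOperad (M.prod W)).act n p σ x ∈ weightPart M W D' s a n p := by
  cases a with
  | zero =>
    obtain ⟨x, rfl⟩ := hx
    exact ⟨(freeOperad M).act n p σ x, OperadHom.map_act _ σ x⟩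
  | succ a =>
    simp only [weightPart, LinearMap.mem_eqLocus, LinearMap.smul_apply, LinearMap.id_apply]
      at hx ⊢
    rw [anticommutator_act, hx, map_smul]

theorem anticommutator_of_mem_weightPart
    (h0 : ∀ n p x, anticommutator D' s n p ((map (M.inl W)).toFun n p x) = 0) {a n : ℕ} {p : ℤ}
    {x : (freeOperad (M.prod W)).obj n p} (hx : x ∈ weightPart M W D' s a n p) :
    anticommutator D' s n p x = (a : k) • x := by
  cases a with
  | zero =>
    obtain ⟨x, rfl⟩ := hx
    rw [h0, Nat.cast_zero, zero_smul]
  | succ a =>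
    simp only [weightPart, LinearMap.mem_eqLocus, LinearMap.smul_apply, LinearMap.id_apply] at hx
    rw [hx, Nat.cast_succ]

/-- Eigenvalues add because the anticommutator is a derivation; total weight 0 is separate, since
there the part is defined as an image. -/
theorem weightPart_comp
    (h0 : ∀ n p x, anticommutator D' s n p ((map (M.inl W)).toFun n p x) = 0)
    {a b m n r : ℕ} {p q t : ℤ} (hn : m + n = r + 1) (hp : p + q = t) (i : Fin n)
    {f : (freeOperad (M.prod W)).obj m p} {g : (freeOperad (M.prod W)).obj n q}
    (hf : f ∈ weightPart M W D' s a m p) (hg : g ∈ weightPart M W D' s b n q) :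
    (freeOperad (M.prod W)).comp hn hp i f g ∈ weightPart M W D' s (a + b) r t := by
  by_cases hab : a + b = 0
  · obtain ⟨rfl, rfl⟩ := Nat.add_eq_zero_iff.1 hab
    obtain ⟨f, rfl⟩ := hf
    obtain ⟨g, rfl⟩ := hg
    exact ⟨(freeOperad M).comp hn hp i f g, OperadHom.map_comp _ hn hp i f g⟩
  · obtain ⟨c, hc⟩ := Nat.exists_eq_succ_of_ne_zero hab
    have hc' : (c : k) + 1 = a + b := by
      rw [← Nat.cast_add, hc, Nat.cast_succ]
    rw [hc]
    simp only [weightPart, LinearMap.mem_eqLocus, LinearMap.smul_apply, LinearMap.id_apply]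
    rw [anticommutator_comp, anticommutator_of_mem_weightPart h0 hf,
      anticommutator_of_mem_weightPart h0 hg, hc', map_smul, map_smul, LinearMap.smul_apply,
      add_smul]

/-- Weights add under composition, so the sum of the parts is a suboperad; it contains M in weight 0
and W in weight 1. Only spanning is needed, not directness. -/
theorem mem_iSup_weightPart
    (h0 : ∀ n p x, anticommutator D' s n p ((map (M.inl W)).toFun n p x) = 0)
    (h1 : ∀ n p x, anticommutator D' s n p (gen _ n p ((M.inr W).toFun n p x)) =
      gen _ n p ((M.inr W).toFun n p x)) {n : ℕ} {p : ℤ} (x : (freeOperad (M.prod W)).obj n p) :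
    x ∈ ⨆ a, weightPart M W D' s a n p := by
  refine mem_suboperad (C := fun n p => ⨆ a, weightPart M W D' s a n p) ⟨?_, ?_⟩ ?_ x
  · intro n p σ x hx
    have hle : ⨆ a, weightPart M W D' s a n p ≤
        (⨆ a, weightPart M W D' s a n p).comap ((freeOperad (M.prod W)).act n p σ) :=
      iSup_le fun a x hx => Submodule.mem_iSup_of_mem a (weightPart_act σ hx)
    exact hle hx
  · intro m n r p q t hn hp i f g hf hg
    have hle : Submodule.map₂ ((freeOperad (M.prod W)).comp hn hp i)
        (⨆ a, weightPart M W D' s a m p) (⨆ a, weightPart M W D' s a n q) ≤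
        ⨆ a, weightPart M W D' s a r t := by
      rw [Submodule.map₂_iSup_left]
      refine iSup_le fun a => ?_
      rw [Submodule.map₂_iSup_right]
      exact iSup_le fun b => Submodule.map₂_le.2 fun f hf g hg =>
        Submodule.mem_iSup_of_mem (a + b) (weightPart_comp h0 hn hp i hf hg)
    exact hle (Submodule.apply_mem_map₂ _ hf hg)
  · intro n p x
    rw [← inl_fst_add_inr_snd x, map_add]
    refine add_mem (Submodule.mem_iSup_of_mem 0 ⟨gen M n p x.1, rfl⟩)
      (Submodule.mem_iSup_of_mem 1 ?_)
    simp only [weightPart, LinearMap.mem_eqLocus]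
    rw [h1]
    simp

end

/-- If `W` is contractible, then `F(M) → F(M ⊕ W)` is a homology isomorphism. -/
theorem exists_contractible_extension [CharZero k] (D : OperadDifferential (freeOperad M))
    (δ : ∀ (n : ℕ) {p q : ℤ}, q + 1 = p → (W.obj n p →ₗ[k] W.obj n q))
    (hδ : ∀ (n : ℕ) {p q : ℤ} (h : q + 1 = p) (σ : Equiv.Perm (Fin n)) (x : W.obj n p),
      δ n h (W.act n p σ x) = W.act n q σ (δ n h x))
    (hδδ : ∀ (n : ℕ) {p q r : ℤ} (h : q + 1 = p) (h' : r + 1 = q) (x : W.obj n p),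
      δ n h' (δ n h x) = 0)
    (η : ∀ (n : ℕ) {p q : ℤ}, q + -1 = p → (W.obj n p →ₗ[k] W.obj n q))
    (hη : ∀ (n : ℕ) {p q : ℤ} (h : q + -1 = p) (σ : Equiv.Perm (Fin n)) (x : W.obj n p),
      η n h (W.act n p σ x) = W.act n q σ (η n h x))
    (hδη : ∀ n p (x : W.obj n p), δ n rfl (η n (add_neg_cancel_right p 1) x) +
      η n (sub_eq_add_neg p 1).symm (δ n (sub_add_cancel p 1) x) = x) :
    ∃ (D' : OperadDifferential (freeOperad (M.prod W))) (j : DGOperadHom D D')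
      (r : DGOperadHom D' D), j.toOperadHom = map (M.inl W) ∧ j.IsHomologyIso ∧ r.IsHomologyIso ∧
      ∀ (n : ℕ) {p q : ℤ} (h : q + 1 = p) (x : W.obj n p),
        D'.d n h (gen _ n p ((M.inr W).toFun n p x)) =
          gen _ n q ((M.inr W).toFun n q (δ n h x)) := by
  obtain ⟨D', hD'inl, hD'inr⟩ := exists_differential_prod D
    (fun n p q h => gen (M.prod W) n q ∘ₗ (M.inr W).toFun n q ∘ₗ δ n h)
    (fun n p q h σ x => by
      simp only [LinearMap.comp_apply]
      rw [hδ, SymmSeqHom.map_act, gen_act])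
    (fun Δ _ hΔ n p q r h h' x => by
      simp only [LinearMap.comp_apply] at hΔ ⊢
      rw [hΔ, hδδ, map_zero, map_zero])
  simp only [LinearMap.comp_apply] at hD'inr
  -- s extends the contraction η by zero on M.
  obtain ⟨s, hs⟩ := exists_derivation (M := M.prod W) (-1)
    (fun n p q h => gen (M.prod W) n q ∘ₗ (M.inr W).toFun n q ∘ₗ η n h ∘ₗ (M.snd W).toFun n p)
    (fun n p q h σ x => by
      simp only [LinearMap.comp_apply]
      rw [SymmSeqHom.map_act, hη, SymmSeqHom.map_act, gen_act])
  simp only [LinearMap.comp_apply] at hs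
  let j : DGOperadHom D D' := ⟨map (M.inl W), fun {n p q} h x => (hD'inl n h x).symm⟩
  let r : DGOperadHom D' D := ⟨map (M.fst W), map_d_prod hD'inl (map (M.fst W))
    ⟨OperadHom.id _, fun _ _ => rfl⟩ (fun _ _ _ => rfl) (fun n p q h x => by
      rw [hD'inr, map_gen, map_gen, fst_inr, fst_inr, map_zero, map_zero, map_zero])⟩
  have hrj : ∀ n p x, r.toFun n p (j.toFun n p x) = x := fun n p x => map_fst_map_inl x
  have hsj : ∀ {n : ℕ} {p q : ℤ} (h : q + -1 = p) (x : (freeOperad M).obj n p),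
      s.toFun n h ((map (M.inl W)).toFun n p x) = 0 := by
    intro n p q h x
    obtain rfl : q = p + 1 := by omega
    refine mem_suboperad (C := fun n p => LinearMap.ker
      (s.toFun n (add_neg_cancel_right p 1) ∘ₗ (map (M.inl W)).toFun n p)) ⟨?_, ?_⟩ ?_ x
    · intro n p σ x hx
      simp only [LinearMap.mem_ker, LinearMap.comp_apply] at hx ⊢
      rw [OperadHom.map_act, s.map_act, hx, map_zero]
    · intro m n r p q t hn hp i f g hf hg
      simp only [LinearMap.mem_ker, LinearMap.comp_apply] at hf hg ⊢
      rw [OperadHom.map_comp, s.map_comp hn hp (add_neg_cancel_right p 1)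
        (add_neg_cancel_right q 1) _ (by omega) (by omega), hf, hg]
      simp
    · intro n p x
      simp [hs]
  -- On generators s takes values in W, which the projection to F(M) kills; the Leibniz rule
  -- propagates this.
  have hrs : ∀ {n : ℕ} {p q : ℤ} (h : q + -1 = p) (x : (freeOperad (M.prod W)).obj n p),
      (map (M.fst W)).toFun n q (s.toFun n h x) = 0 := by
    intro n p q h x
    obtain rfl : q = p + 1 := by omega
    refine mem_suboperad (C := fun n p => LinearMap.ker
      ((map (M.fst W)).toFun n _ ∘ₗ s.toFun n (add_neg_cancel_right p 1))) ⟨?_, ?_⟩ ?_ x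
    · intro n p σ x hx
      simp only [LinearMap.mem_ker, LinearMap.comp_apply] at hx ⊢
      rw [s.map_act, OperadHom.map_act, hx, map_zero]
    · intro m n r p q t hn hp i f g hf hg
      simp only [LinearMap.mem_ker, LinearMap.comp_apply] at hf hg ⊢
      rw [s.map_comp hn hp (add_neg_cancel_right p 1)
        (add_neg_cancel_right q 1) _ (by omega) (by omega), map_add, map_smul,
        OperadHom.map_comp, OperadHom.map_comp, hf, hg]
      simp
    · intro n p x
      simp [hs]
  have h0 : ∀ n p x, anticommutator D' s n p ((map (M.inl W)).toFun n p x) = 0 := by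
    intro n p x
    simp only [anticommutator, LinearMap.add_apply, LinearMap.comp_apply]
    rw [hsj, hD'inl, hsj, map_zero, zero_add]
  have h1 : ∀ n p x, anticommutator D' s n p (gen _ n p ((M.inr W).toFun n p x)) =
      gen _ n p ((M.inr W).toFun n p x) := by
    intro n p x
    simp only [anticommutator, LinearMap.add_apply, LinearMap.comp_apply]
    rw [hs, snd_inr, hD'inr, hD'inr, hs, snd_inr, ← map_add, ← map_add, hδη]
  -- Applying r to (d s + s d) z = (a + 1) z gives d r s z + r s d z = 0 on the left, hence r z = 0.
  have hr0 : ∀ n p, ∀ z ∈ ⨆ a, weightPart M W D' s (a + 1) n p,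
      (map (M.fst W)).toFun n p z = 0 := by
    intro n p z hz
    refine (iSup_le fun a z hz => ?_ : _ ≤ LinearMap.ker ((map (M.fst W)).toFun n p)) hz
    rw [LinearMap.mem_ker]
    simp only [weightPart, LinearMap.mem_eqLocus, LinearMap.smul_apply, LinearMap.id_apply] at hz
    have hz' := congrArg ((map (M.fst W)).toFun n p) hz
    simp only [anticommutator, LinearMap.add_apply, LinearMap.comp_apply, map_add] at hz'
    have hrd := r.map_d (rfl : p + 1 = p + 1) (s.toFun n (add_neg_cancel_right p 1) z)
    rw [show r.toOperadHom = map (M.fst W) from rfl, hrs, map_zero] at hrd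
    rw [hrs, hrd, zero_add, map_smul] at hz'
    exact (smul_eq_zero.1 hz'.symm).resolve_left (by exact_mod_cast a.succ_ne_zero)
  have hj : j.IsHomologyIso := by
    refine j.isHomologyIso_iff.2 fun n => ⟨?_, ?_⟩
    · intro p q t h h' x y _ hxy
      exact ⟨r.toFun n t y, by rw [← r.map_d, ← hxy, hrj]⟩
    · intro p q t h h' y hy
      obtain rfl := eq_sub_of_add_eq h
      subst h'
      -- Split the cycle y as j x + z with z of positive weight. Then x = r y is a cycle, so z is a
      -- cycle too and hence a boundary.
      have hy' := mem_iSup_weightPart h0 h1 y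
      rw [← sup_iSup_nat_succ] at hy'
      obtain ⟨_, ⟨x, rfl⟩, z, hz, hxz⟩ := Submodule.mem_sup.1 hy'
      have hx : r.toFun n p y = x := by
        rw [← hxz, map_add]
        change _ + (map (M.fst W)).toFun n p z = x
        rw [hr0 n p z hz, add_zero]
        exact hrj n p x
      have hdx : D.d n h x = 0 := by rw [← hx, ← r.map_d, hy, map_zero]
      have hdz : D'.d n h z = 0 := by
        rw [← hxz, map_add, hD'inl, hdx, map_zero, zero_add] at hy
        exact hy
      obtain ⟨t, ht⟩ := exists_d_eq_of_mem_iSup hdz hz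
      exact ⟨x, t, hdx, by rw [ht]; exact hxz⟩
  exact ⟨D', j, r, rfl, hj,
    ((r.comp j).isHomologyIso_of_eq_self hrj).of_comp_right hj, hD'inr⟩

/-- If there is a homology isomorphism `F(M) → S`, then there are homology isomorphisms
`F(M) ← P → S` of which the second one is surjective. -/
theorem exists_factorization [CharZero k] {S : NonunitalOperad.{u, w} k}
    {G : OperadDifferential S} (hS : ∀ p, Subsingleton (S.obj 1 p))
    {D : OperadDifferential (freeOperad M)} (ν : DGOperadHom D G) (hν : ν.IsHomologyIso) :
    ∃ (P : NonunitalOperad.{u, max u v w} k) (E : OperadDifferential P) (π : DGOperadHom E G)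
      (r : DGOperadHom E D), π.IsHomologyIso ∧ r.IsHomologyIso ∧
      ∀ n p, Function.Surjective (π.toFun n p) := by
  -- W is S together with a shifted copy, with δ (a, b) = (0, a) and contraction η (a, b) = (b, 0).
  -- It is a collection because S vanishes in arity 1.
  let W : OperadCollection.{u, w} k :=
    { obj n p := S.obj n p × S.obj n (p + 1)
      act n p :=
        { toFun σ := (S.act n p σ).prodMap (S.act n (p + 1) σ)
          map_one' := by ext <;> simp
          map_mul' σ τ := by ext <;> simp }
      subsingleton_obj n p hn := by
        have h : ∀ q, Subsingleton (S.obj n q) := fun q => by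
          obtain rfl | rfl : n = 0 ∨ n = 1 := by omega
          · exact S.subsingleton_obj_zero q
          · exact hS q
        have := h p
        have := h (p + 1)
        infer_instance }
  obtain ⟨δ, hδ⟩ : ∃ δ : ∀ (n : ℕ) {p q : ℤ}, q + 1 = p → (W.obj n p →ₗ[k] W.obj n q),
      ∀ (n : ℕ) {q : ℤ} (h : q + 1 = q + 1) (x : W.obj n (q + 1)), δ n h x = (0, x.1) :=
    ⟨fun n p q h => h ▸ (LinearMap.inr k (S.obj n q) (S.obj n (q + 1)) ∘ₗ
      LinearMap.fst k (S.obj n (q + 1)) (S.obj n (q + 1 + 1))), fun _ _ _ _ => rfl⟩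
  obtain ⟨η, hη⟩ : ∃ η : ∀ (n : ℕ) {p q : ℤ}, q + -1 = p → (W.obj n p →ₗ[k] W.obj n q),
      ∀ (n : ℕ) {p : ℤ} (h : p + 1 + -1 = p) (x : W.obj n p), η n h x = (x.2, 0) :=
    ⟨fun n p q h => (by omega : p + 1 = q) ▸ (LinearMap.inl k (S.obj n (p + 1))
      (S.obj n (p + 1 + 1)) ∘ₗ LinearMap.snd k (S.obj n p) (S.obj n (p + 1))),
      fun _ _ _ _ => rfl⟩
  obtain ⟨D', j, r, hj, hjiso, hr, hD'⟩ := exists_contractible_extension (W := W) D δ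
    (by
      intro n p q h σ x
      subst h
      rw [hδ, hδ]
      exact Prod.ext (map_zero (S.act n q σ)).symm rfl)
    (by
      intro n p q r h h' x
      subst h'
      subst h
      rw [hδ, hδ]
      rfl)
    η
    (by
      intro n p q h σ x
      obtain rfl : q = p + 1 := by omega
      rw [hη, hη]
      exact Prod.ext rfl (map_zero (S.act n _ σ)).symm)
    (by
      intro n p x
      have key : ∀ {q : ℤ} (h : q + 1 = p) (h' : p + -1 = q), η n h' (δ n h x) = (x.1, 0) := by
        intro q h h'
        subst h
        rw [hδ, hη]
      rw [key, hη, hδ]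
      exact Prod.ext (zero_add x.1) (add_zero x.2))
  -- The map (a, b) ↦ a + d b commutes with the differentials, and is surjective already on b = 0.
  let ϖ : SymmSeqHom W.toSymmSeq S.toSymmSeq :=
    { toFun n p := LinearMap.fst k _ _ + G.d n rfl ∘ₗ LinearMap.snd k _ _
      map_act {n p} σ x := by
        change S.act n p σ x.1 + G.d n rfl (S.act n (p + 1) σ x.2) =
          S.act n p σ (x.1 + G.d n rfl x.2)
        rw [G.d_act, map_add] }
  let ψ : OperadHom (freeOperad (M.prod W)) S := lift
    (desc (ν.toOperadHom.toSymmSeqHom.comp (genHom M)) ϖ)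
  have hψinl : ∀ n p x, ψ.toFun n p (gen _ n p ((M.inl W).toFun n p x)) =
      ν.toFun n p (gen M n p x) := fun n p x => by
    simp [ψ, SymmSeqHom.comp, OperadHom.toSymmSeqHom]
  have hψinr : ∀ n p x, ψ.toFun n p (gen _ n p ((M.inr W).toFun n p x)) = ϖ.toFun n p x :=
    fun n p x => by simp [ψ]
  let π : DGOperadHom D' G := ⟨ψ, map_d_prod
    (fun n p q h x => by rw [← hj]; exact (j.map_d h x).symm) ψ ν hψinl (by
      intro n p q h x
      subst h
      rw [hD', hψinr, hψinr, hδ]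
      change 0 + G.d n rfl x.1 = G.d n rfl (x.1 + G.d n rfl x.2)
      rw [map_add, G.d_d, zero_add, add_zero])⟩
  have hπj : ∀ n p x, (π.comp j).toFun n p x = ν.toFun n p x := fun n p x => by
    refine hom_eq (φ := ψ.comp j.toOperadHom) (ψ := ν.toOperadHom) (fun n p x => ?_) x
    rw [hj]
    exact hψinl n p x
  refine ⟨_, D', π, r, ?_, hr, ?_⟩
  · exact (hν.congr fun n p x => (hπj n p x).symm).of_comp_right hjiso
  · intro n p y
    refine ⟨gen _ n p ((M.inr W).toFun n p (y, 0)), (hψinr n p _).trans ?_⟩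
    change y + G.d n rfl 0 = y
    rw [map_zero, add_zero]

/-- Uniqueness of minimal models. -/
theorem nonempty_dgOperadIso [CharZero k] {M' : OperadCollection.{u, v₁} k}
    {S : NonunitalOperad.{u, w} k} {G : OperadDifferential S}
    (hS : ∀ p, Subsingleton (S.obj 1 p)) {D : OperadDifferential (freeOperad M)}
    {D' : OperadDifferential (freeOperad M')} (ν : DGOperadHom D G) (ν' : DGOperadHom D' G)
    (hD : IsMinimal D) (hν : ν.IsHomologyIso) (hD' : IsMinimal D') (hν' : ν'.IsHomologyIso) :
    Nonempty (DGOperadIso D D') := by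
  -- Only ν' is factored; ν is lifted through π, and r carries the lift φ back to F(M').
  -- Two-out-of-three makes φ a homology isomorphism.
  obtain ⟨P, E, π, r, hπ, hr, hsurj⟩ := exists_factorization hS ν' hν'
  obtain ⟨φ, hφ⟩ := exists_lift (ν := ν) hD hπ hsurj
  have hφ' : φ.IsHomologyIso :=
    (hν.congr (ψ := π.comp φ) fun n p x => (hφ n p x).symm).of_comp_left hπ
  exact ⟨DGOperadHom.isoOfBijective (r.comp φ)
    (bijective_of_isHomologyIso hD hD' (r.comp φ) (hr.comp hφ'))⟩

end FreeOperad

/-! ### The mapping cone and the addition of generators of one arity -/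

namespace FreeOperad

open OperadCollection

theorem map_mem_decomposables {k : Type u} [Field k] {M : OperadCollection.{u, v} k}
    {M' : OperadCollection.{u, w} k} (φ : OperadHom (freeOperad M) (freeOperad M')) {n : ℕ} {p : ℤ}
    {x : (freeOperad M).obj n p} (hx : x ∈ decomposables M n p) :
    φ.toFun n p x ∈ decomposables M' n p := by
  refine (Submodule.span_le.2 ?_ :
    decomposables M n p ≤ (decomposables M' n p).comap (φ.toFun n p)) hx
  rintro _ ⟨m, l, q, s, hn, hp, i, f, g, σ, hm, hl, rfl⟩
  rw [SetLike.mem_coe, Submodule.mem_comap, φ.map_act, φ.map_comp]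
  exact act_mem_decomposables σ (comp_mem_decomposables hn hp i _ _)

/-- Only bijectivity in the arity n is required, so this compares operads that differ by generators
of higher arity. -/
theorem _root_.DGOperadHom.homologyAt_of_bijective {k : Type u} [Field k]
    {P : NonunitalOperad.{u, v₁} k} {Q : NonunitalOperad.{u, v₂} k} {R : NonunitalOperad.{u, v₃} k}
    {D : OperadDifferential P} {E : OperadDifferential Q} {G : OperadDifferential R}
    (a : DGOperadHom D E) (φ : DGOperadHom D G) (ψ : DGOperadHom E G)
    (h : ∀ n p x, ψ.toFun n p (a.toFun n p x) = φ.toFun n p x) {n : ℕ}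
    (ha : ∀ p, Function.Bijective (a.toFun n p))
    (hφ : φ.HomologyInjectiveAt n ∧ φ.HomologySurjectiveAt n) :
    ψ.HomologyInjectiveAt n ∧ ψ.HomologySurjectiveAt n := by
  refine ⟨fun {p q r} h₁ h₂ x y hx hxy => ?_, fun h₁ h₂ y hy => ?_⟩
  · obtain ⟨x, rfl⟩ := (ha p).2 x
    rw [← a.map_d, map_eq_zero_iff _ (ha q).1] at hx
    obtain ⟨z, rfl⟩ := hφ.1 h₁ h₂ x y hx (by rw [← h, hxy])
    exact ⟨a.toFun n r z, (a.map_d h₂ z).symm⟩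
  · obtain ⟨x, z, hx, hxz⟩ := hφ.2 h₁ h₂ y hy
    exact ⟨a.toFun n _ x, z, by rw [← a.map_d, hx, map_zero], by rw [h, hxz]⟩

section Cone

variable {k : Type u} [Field k] {M : OperadCollection.{u, v} k} {S : NonunitalOperad.{u, w} k}
  {D : OperadDifferential (freeOperad M)} {G : OperadDifferential S} (ν : DGOperadHom D G)

/-- The action of the symmetric group on the mapping cone. -/
def coneAct (M : OperadCollection.{u, v} k) (S : NonunitalOperad.{u, w} k) (n : ℕ) (p : ℤ) :
    Representation k (Equiv.Perm (Fin n)) ((freeOperad M).obj n (p - 1) × S.obj n p) where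
  toFun σ := ((freeOperad M).act n (p - 1) σ).prodMap (S.act n p σ)
  map_one' := by ext <;> simp
  map_mul' σ τ := by ext <;> simp

/-- The cycles of the mapping cone, with a convenient choice of signs. -/
def coneCycles (n : ℕ) (p : ℤ) : Submodule k ((freeOperad M).obj n (p - 1) × S.obj n p) :=
  LinearMap.ker (D.d n (sub_add_cancel (p - 1) 1) ∘ₗ LinearMap.fst k _ _) ⊓
    LinearMap.eqLocus (ν.toFun n (p - 1) ∘ₗ LinearMap.fst k _ _)
      (G.d n (sub_add_cancel p 1) ∘ₗ LinearMap.snd k _ _)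

/-- The boundaries of the mapping cone. -/
def coneBoundaries (n : ℕ) (p : ℤ) : Submodule k ((freeOperad M).obj n (p - 1) × S.obj n p) :=
  LinearMap.range ((D.d n (sub_add_cancel p 1) ∘ₗ LinearMap.fst k _ _).prod
    (ν.toFun n p ∘ₗ LinearMap.fst k _ (S.obj n (p + 1)) + G.d n rfl ∘ₗ LinearMap.snd k _ _))

theorem mem_coneCycles {n : ℕ} {p : ℤ} {x : (freeOperad M).obj n (p - 1) × S.obj n p} :
    x ∈ coneCycles ν n p ↔ D.d n (sub_add_cancel (p - 1) 1) x.1 = 0 ∧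
      ν.toFun n (p - 1) x.1 = G.d n (sub_add_cancel p 1) x.2 := Iff.rfl

theorem mem_coneBoundaries {n : ℕ} {p : ℤ} {x : (freeOperad M).obj n (p - 1) × S.obj n p} :
    x ∈ coneBoundaries ν n p ↔ ∃ c s, D.d n (sub_add_cancel p 1) c = x.1 ∧
      ν.toFun n p c + G.d n rfl s = x.2 :=
  ⟨fun ⟨y, hy⟩ => ⟨y.1, y.2, congrArg Prod.fst hy, congrArg Prod.snd hy⟩,
    fun ⟨c, s, hc, hs⟩ => ⟨(c, s), Prod.ext hc hs⟩⟩

theorem mk_mem_coneBoundaries {n : ℕ} {p r : ℤ} (h : p + 1 = r) (c : (freeOperad M).obj n p)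
    (s : S.obj n r) : (D.d n (sub_add_cancel p 1) c, ν.toFun n p c + G.d n h s) ∈
      coneBoundaries ν n p := by
  subst h
  exact (mem_coneBoundaries ν).2 ⟨c, s, rfl, rfl⟩

/-- Provides Σ-stable representatives of the homology of the cone; in the critical arity they become
the new generators. -/
theorem exists_cone_complement [CharZero k] (n : ℕ) (p : ℤ) :
    ∃ N : Submodule k ((freeOperad M).obj n (p - 1) × S.obj n p),
      (∀ σ, ∀ x ∈ N, coneAct M S n p σ x ∈ N) ∧ N ≤ coneCycles ν n p ∧
      N ⊓ coneBoundaries ν n p = ⊥ ∧ coneCycles ν n p ≤ N ⊔ coneBoundaries ν n p := by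
  refine Representation.exists_stable_complement (coneAct M S n p) _ _ ?_ ?_ ?_
  · intro x hx
    obtain ⟨c, s, hc, hs⟩ := (mem_coneBoundaries ν).1 hx
    rw [mem_coneCycles, ← hc, ← hs, D.d_d, ν.map_d, map_add, G.d_d, add_zero]
    exact ⟨rfl, rfl⟩
  · intro σ x hx
    obtain ⟨c, s, hc, hs⟩ := (mem_coneBoundaries ν).1 hx
    refine (mem_coneBoundaries ν).2 ⟨(freeOperad M).act n p σ c, S.act n (p + 1) σ s, ?_, ?_⟩
    · rw [D.d_act, hc]
      rfl
    · rw [ν.map_act, G.d_act, ← map_add, hs]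
      rfl
  · intro σ x hx
    rw [mem_coneCycles] at hx ⊢
    change D.d n _ ((freeOperad M).act n (p - 1) σ x.1) = 0 ∧
      ν.toFun n (p - 1) ((freeOperad M).act n (p - 1) σ x.1) = G.d n _ (S.act n p σ x.2)
    rw [D.d_act, ν.map_act, G.d_act, hx.1, hx.2, map_zero]
    exact ⟨rfl, rfl⟩

end Cone

section Models

variable {k : Type u} [Field k] {S : NonunitalOperad.{u, v} k}

/-- A minimal model in arities `≤ N + 1`, with generators in these arities. -/
structure ModelUpTo (G : OperadDifferential S) (N : ℕ) where
  M : OperadCollection.{u, max u v} k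
  D : OperadDifferential (freeOperad M)
  ν : DGOperadHom D G
  subsingleton_obj : ∀ n p, N + 1 < n → Subsingleton (M.obj n p)
  isMinimal : IsMinimal D
  homologyAt : ∀ n ≤ N + 1, ν.HomologyInjectiveAt n ∧ ν.HomologySurjectiveAt n

/-- An extension of a model to one more arity. -/
structure ModelUpTo.Extension {G : OperadDifferential S} {N : ℕ} (X : ModelUpTo G N) where
  W : OperadCollection.{u, max u v} k
  D : OperadDifferential (freeOperad (X.M.prod W))
  ν : DGOperadHom D G
  subsingleton_obj : ∀ n p, n ≠ N + 2 → Subsingleton (W.obj n p)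
  d_inl : ∀ (n : ℕ) {p q : ℤ} (h : q + 1 = p) (x : (freeOperad X.M).obj n p),
    D.d n h ((map (X.M.inl W)).toFun n p x) = (map (X.M.inl W)).toFun n q (X.D.d n h x)
  ν_inl : ∀ n p x, ν.toFun n p ((map (X.M.inl W)).toFun n p x) = X.ν.toFun n p x
  isMinimal : IsMinimal D
  homologyAt : ∀ n ≤ N + 2, ν.HomologyInjectiveAt n ∧ ν.HomologySurjectiveAt n

variable {G : OperadDifferential S}

/-- New generators of arity N + 2 kill the homology of the cone of ν there: boundaries in the
complement are zero, which prevents unwanted new cycles, and every cone cycle lies in the complement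
modulo boundaries. -/
theorem ModelUpTo.nonempty_extension [CharZero k] {N : ℕ} (X : ModelUpTo G N) :
    Nonempty X.Extension := by
  obtain ⟨M, D, ν, hM, hD, hν⟩ := X
  have hcone : ∀ n p, ∃ C : Submodule k ((freeOperad M).obj n (p - 1) × S.obj n p),
      (∀ σ, ∀ x ∈ C, coneAct M S n p σ x ∈ C) ∧ C ≤ coneCycles ν n p ∧
      (n ≠ N + 2 → C = ⊥) ∧ (n = N + 2 → C ⊓ coneBoundaries ν n p = ⊥ ∧
        coneCycles ν n p ≤ C ⊔ coneBoundaries ν n p) := by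
    intro n p
    by_cases hn : n = N + 2
    · obtain ⟨C, h1, h2, h3, h4⟩ := exists_cone_complement ν n p
      exact ⟨C, h1, h2, fun h => absurd hn h, fun _ => ⟨h3, h4⟩⟩
    · refine ⟨⊥, ?_, bot_le, fun _ => rfl, fun h => absurd h hn⟩
      rintro σ x rfl
      rw [map_zero]
      exact zero_mem _
  choose C hC hCZ hCbot hCcompl using hcone
  have hCsub : ∀ n p, n ≠ N + 2 → Subsingleton (C n p) := fun n p hn => by
    rw [hCbot n p hn]
    infer_instance
  let W : OperadCollection.{u, max u v} k :=
    { obj n p := C n p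
      act n p :=
        { toFun σ := (coneAct M S n p σ).restrict (hC n p σ)
          map_one' := by ext x <;> simp
          map_mul' σ τ := by ext x <;> simp }
      subsingleton_obj n p hn := hCsub n p (by omega) }
  -- For d y = y.1.1 and ν y = y.1.2, the two cone cycle conditions say d² y = 0 and ν d y = d ν y.
  have hWcyc : ∀ n p (y : W.obj n p), D.d n (sub_add_cancel (p - 1) 1) y.1.1 = 0 ∧
      ν.toFun n (p - 1) y.1.1 = G.d n (sub_add_cancel p 1) y.1.2 := fun n p y => hCZ n p y.2
  obtain ⟨δ, hδ⟩ : ∃ δ : ∀ (n : ℕ) {p q : ℤ}, q + 1 = p →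
      (W.obj n p →ₗ[k] (freeOperad (M.prod W)).obj n q),
      ∀ (n : ℕ) {p : ℤ} (h : p - 1 + 1 = p) (y : W.obj n p),
        δ n h y = (map (M.inl W)).toFun n (p - 1) y.1.1 :=
    ⟨fun n p q h => (eq_sub_of_add_eq h) ▸ ((map (M.inl W)).toFun n (p - 1) ∘ₗ
      LinearMap.fst k ((freeOperad M).obj n (p - 1)) (S.obj n p) ∘ₗ (C n p).subtype :
        W.obj n p →ₗ[k] (freeOperad (M.prod W)).obj n (p - 1)), fun _ _ _ _ => rfl⟩
  obtain ⟨D', hD'inl, hD'inr⟩ := exists_differential_prod D δ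
    (by
      intro n p q h σ y
      obtain rfl := eq_sub_of_add_eq h
      rw [hδ, hδ, ← OperadHom.map_act]
      rfl)
    (by
      intro Δ hΔ _ n p q r h h' y
      obtain rfl := eq_sub_of_add_eq h
      obtain rfl := eq_sub_of_add_eq h'
      rw [hδ, hΔ, (hWcyc n p y).1, map_zero])
  let ζ : SymmSeqHom W.toSymmSeq S.toSymmSeq :=
    { toFun n p := LinearMap.snd k ((freeOperad M).obj n (p - 1)) (S.obj n p) ∘ₗ (C n p).subtype
      map_act _ _ := rfl }
  let ψ : OperadHom (freeOperad (M.prod W)) S := lift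
    (desc (ν.toOperadHom.toSymmSeqHom.comp (genHom M)) ζ)
  have hψinl : ∀ n p x, ψ.toFun n p ((map (M.inl W)).toFun n p x) = ν.toFun n p x := fun n p x =>
    hom_eq (φ := ψ.comp (map (M.inl W))) (ψ := ν.toOperadHom) (fun n p x => by
      change ψ.toFun n p (gen _ n p _) = _
      simp [ψ, SymmSeqHom.comp, OperadHom.toSymmSeqHom]) x
  have hψinr : ∀ n p (y : W.obj n p), ψ.toFun n p (gen _ n p ((M.inr W).toFun n p y)) = y.1.2 :=
    fun n p y => by
      change _ = ζ.toFun n p y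
      simp [ψ]
  let ν' : DGOperadHom D' G := ⟨ψ, map_d_prod hD'inl ψ ν (fun n p x => hψinl n p (gen M n p x)) (by
    intro n p q h y
    obtain rfl := eq_sub_of_add_eq h
    rw [hD'inr, hδ, hψinl, hψinr]
    exact (hWcyc n p y).2)⟩
  let j : DGOperadHom D D' := ⟨map (M.inl W), fun {n p q} h x => (hD'inl n h x).symm⟩
  have hinj : ∀ n p, Function.Injective ((map (M.inl W)).toFun n p) := fun n p =>
    Function.LeftInverse.injective (g := (map (M.fst W)).toFun n p) map_fst_map_inl
  have hsurj : ∀ n ≤ N + 1, ∀ p, Function.Surjective ((map (M.inl W)).toFun n p) := by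
    intro n hn p x
    refine ⟨(map (M.fst W)).toFun n p x, map_map_of_le (M.fst W) (M.inl W) (N + 1) ?_ hn x⟩
    intro n hn p x
    have := hCsub n p (by omega)
    exact Prod.ext rfl (Subsingleton.elim (α := C n p) _ _)
  -- Nothing changes below arity N + 2, so all decomposables of that arity come from F(M), and only
  -- W itself is added.
  have hdecomp : ∀ p (x : (freeOperad (M.prod W)).obj (N + 2) p),
      ∃ c y, x = (map (M.inl W)).toFun _ p c + gen _ _ p ((M.inr W).toFun _ p y) := by
    intro p x
    obtain ⟨y, z, hz, rfl⟩ := exists_eq_gen_add x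
    obtain ⟨c, -, rfl⟩ := exists_decomposable_preimage (map (M.inl W))
      (fun m hm => hsurj m (by omega)) hz
    refine ⟨gen M _ p ((M.fst W).toFun _ p y) + c, (M.snd W).toFun _ p y, ?_⟩
    conv_lhs => rw [← inl_fst_add_inr_snd y]
    rw [map_add, map_add, map_gen]
    abel
  refine ⟨⟨W, D', ν', hCsub, hD'inl, hψinl, isMinimal_iff.2 ?_, ?_⟩⟩
  · intro n p q h x
    obtain rfl := eq_sub_of_add_eq h
    rw [← inl_fst_add_inr_snd x, map_add, map_add, hD'inr, hδ, ← map_gen, hD'inl]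
    refine add_mem (map_mem_decomposables _ (hD.d_mem_decomposables h _)) ?_
    refine map_mem_decomposables _ ?_
    -- F(M) has no generators of arity N + 2, so every element of that arity, in particular d y, is
    -- decomposable.
    by_cases hn : n = N + 2
    · obtain ⟨y, z, hz, hyz⟩ := exists_eq_gen_add ((M.snd W).toFun n p x).1.1
      have := hM n (p - 1) (by omega)
      rw [hyz, Subsingleton.elim y 0, map_zero, zero_add]
      exact hz
    · have := hCsub n p hn
      rw [Subsingleton.elim (α := C n p) ((M.snd W).toFun n p x) 0]
      exact zero_mem _
  · intro n hn
    obtain hn | rfl := Nat.le_succ_iff.1 hn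
    · exact DGOperadHom.homologyAt_of_bijective j ν ν' hψinl
        (fun p => ⟨hinj n p, hsurj n hn p⟩) (hν n hn)
    constructor
    · intro p q r h h' x t hx hxt
      obtain rfl := eq_sub_of_add_eq h
      obtain rfl := eq_sub_of_add_eq h'
      obtain ⟨c, y, rfl⟩ := hdecomp _ x
      rw [map_add, hD'inl, hD'inr, hδ, ← map_add, map_eq_zero_iff _ (hinj _ _)] at hx
      change ψ.toFun _ _ _ = _ at hxt
      rw [map_add, hψinl, hψinr] at hxt
      -- From d c + y.1.1 = 0 and ν c + y.1.2 = d t, the pair y is the cone boundary of (-c, t);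
      -- boundaries meet C trivially.
      have hy : y = 0 := by
        have : y.1 ∈ C (N + 2) (r - 1) ⊓ coneBoundaries ν (N + 2) (r - 1) := by
          refine ⟨y.2, ?_⟩
          have hb := mk_mem_coneBoundaries ν (n := N + 2) (sub_add_cancel r 1) (-c) t
          rwa [map_neg, map_neg, ← hxt, ← eq_neg_of_add_eq_zero_right hx, neg_add_cancel_left]
            at hb
        rw [(hCcompl _ _ rfl).1] at this
        exact Subtype.ext this
      subst hy
      have hmem : ((c, t) : (freeOperad M).obj (N + 2) (r - 1) × S.obj (N + 2) r) ∈
          coneCycles ν (N + 2) r := by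
        refine (mem_coneCycles ν).2 ⟨(add_zero _).symm.trans hx, ?_⟩
        rw [← hxt]
        exact (add_zero _).symm
      -- Modulo boundaries the cone cycle (c, t) is a new generator y, so c = d y + d c' in the
      -- extension.
      obtain ⟨y, hy, b, hb, hyb⟩ := Submodule.mem_sup.1 ((hCcompl _ _ rfl).2 hmem)
      obtain ⟨c', s, hc, -⟩ := (mem_coneBoundaries ν).1 hb
      refine ⟨gen _ _ r ((M.inr W).toFun _ r ⟨y, hy⟩) + (map (M.inl W)).toFun _ r c', ?_⟩
      rw [map_add, hD'inl, hD'inr, hδ, ← map_add, hc, map_zero, map_zero, add_zero]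
      exact congrArg _ (congrArg Prod.fst hyb)
    · intro p q r h h' t ht
      obtain rfl := eq_sub_of_add_eq h
      subst h'
      -- A cycle t of S is the cone cycle (0, t); its decomposition yields a cycle y + c mapping to
      -- t up to a boundary.
      have hmem : ((0, t) : (freeOperad M).obj (N + 2) (p - 1) × S.obj (N + 2) p) ∈
          coneCycles ν (N + 2) p :=
        (mem_coneCycles ν).2 ⟨map_zero _, by rw [map_zero]; exact ht.symm⟩
      obtain ⟨y, hy, b, hb, hyb⟩ := Submodule.mem_sup.1 ((hCcompl _ _ rfl).2 hmem)
      obtain ⟨c, s, hc, hs⟩ := (mem_coneBoundaries ν).1 hb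
      have h1 : y.1 + D.d _ h c = 0 := by rw [hc]; exact congrArg Prod.fst hyb
      have h2 : y.2 + (ν.toFun _ _ c + G.d _ rfl s) = t := by rw [hs]; exact congrArg Prod.snd hyb
      refine ⟨gen _ _ p ((M.inr W).toFun _ p ⟨y, hy⟩) + (map (M.inl W)).toFun _ p c, s, ?_, ?_⟩
      · rw [map_add, hD'inl, hD'inr, hδ, ← map_add, h1, map_zero]
      · change ψ.toFun _ _ _ + _ = t
        rw [map_add, hψinl, hψinr, ← h2, add_assoc]

end Models

end FreeOperad

/-! ### The limit of the successive extensions -/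

namespace FreeOperad

open OperadCollection

section Models

variable {k : Type u} [Field k] {S : NonunitalOperad.{u, v} k} {G : OperadDifferential S}

/-- The model without generators. -/
theorem ModelUpTo.nonempty_zero (hS : ∀ p, Subsingleton (S.obj 1 p)) :
    Nonempty (ModelUpTo G 0) := by
  have hS' : ∀ n ≤ 1, ∀ p, Subsingleton (S.obj n p) := fun n hn p => by
    obtain rfl | rfl : n = 0 ∨ n = 1 := by omega
    · exact S.subsingleton_obj_zero p
    · exact hS p
  let M : OperadCollection.{u, max u v} k :=
    { obj _ _ := PUnit
      act _ _ := 1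
      subsingleton_obj _ _ _ := inferInstanceAs (Subsingleton PUnit) }
  have hM : ∀ n p, Subsingleton (M.obj n p) := fun _ _ => inferInstanceAs (Subsingleton PUnit)
  obtain ⟨D, hD⟩ := exists_differential (M := M) (fun _ _ _ _ => 0) (fun _ _ _ _ _ _ => by simp)
    (fun _ _ _ _ _ _ _ _ _ => by simp)
  let φ : OperadHom (freeOperad M) S := lift ⟨fun _ _ => 0, fun _ _ => by simp⟩
  have hφ : ∀ (n : ℕ) {p q : ℤ} (h : q + 1 = p) (x : M.obj n p),
      φ.toFun n q (D.d n h (gen M n p x)) = G.d n h (φ.toFun n p (gen M n p x)) := by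
    intro n p q h x
    rw [hD]
    simp [φ]
  refine ⟨⟨M, D, ⟨φ, map_d_of_gen D G φ hφ⟩, fun n p _ => hM n p, isMinimal_iff.2 ?_, ?_⟩⟩
  · intro n p q h x
    rw [hD]
    exact zero_mem _
  · intro n hn
    refine ⟨fun _ _ x _ _ _ => ⟨0, ?_⟩, fun {p _ _} _ _ y _ => ⟨0, 0, map_zero _, ?_⟩⟩
    · rw [map_zero, eq_zero_of_lt_two (by omega) x]
    · have := hS' n hn p
      exact Subsingleton.elim _ _

/-- A chosen extension of a model. -/
noncomputable def ModelUpTo.extension [CharZero k] {N : ℕ} (X : ModelUpTo G N) : X.Extension :=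
  X.nonempty_extension.some

/-- The next model. -/
noncomputable def ModelUpTo.next [CharZero k] {N : ℕ} (X : ModelUpTo G N) :
    ModelUpTo G (N + 1) where
  M := X.M.prod X.extension.W
  D := X.extension.D
  ν := X.extension.ν
  subsingleton_obj n p hn :=
    have := X.subsingleton_obj n p (by omega)
    have := X.extension.subsingleton_obj n p (by omega)
    inferInstanceAs (Subsingleton (X.M.obj n p × X.extension.W.obj n p))
  isMinimal := X.extension.isMinimal
  homologyAt := X.extension.homologyAt

variable [CharZero k] (X₀ : ModelUpTo G 0)

/-- The sequence of models obtained by successive extensions. -/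
noncomputable def stage : ∀ n, ModelUpTo G n
  | 0 => X₀
  | n + 1 => (stage n).next

/-- The generators of arity `n + 2`. -/
noncomputable abbrev newGenerators (n : ℕ) : OperadCollection.{u, max u v} k :=
  (stage X₀ n).extension.W

/-- The collection of all generators. -/
noncomputable def limitCollection : OperadCollection.{u, max u v} k where
  -- In arity j only the factor n = j - 2 can be nonzero, so this product is also the direct sum.
  obj j p := ∀ n, (newGenerators X₀ n).obj j p
  act j p :=
    { toFun σ := LinearMap.pi fun n => (newGenerators X₀ n).act j p σ ∘ₗ LinearMap.proj n
      map_one' := by ext; simp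
      map_mul' σ τ := by ext; simp }
  subsingleton_obj j p hj :=
    have := fun n => (newGenerators X₀ n).subsingleton_obj j p hj
    inferInstance

/-- The projection from all generators to those of a stage. -/
noncomputable def toStage :
    ∀ n, SymmSeqHom (limitCollection X₀).toSymmSeq (stage X₀ n).M.toSymmSeq
  -- Stage 0 has only zero generators: they vanish in arities < 2 by definition and in arities > 1
  -- by `X₀.subsingleton_obj`.
  | 0 => ⟨fun _ _ => 0, fun _ _ => by simp⟩
  | n + 1 =>
    { toFun j p := ((toStage n).toFun j p).prod
        (LinearMap.proj (φ := fun n => (newGenerators X₀ n).obj j p) n)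
      map_act σ x := Prod.ext ((toStage n).map_act σ x) rfl }

/-- The inclusion of one factor in the product. -/
noncomputable def singleGenerator (n : ℕ) :
    SymmSeqHom (newGenerators X₀ n).toSymmSeq (limitCollection X₀).toSymmSeq where
  toFun j p := LinearMap.single k (fun n => (newGenerators X₀ n).obj j p) n
  map_act {j p} σ x := by
    funext i
    exact (Pi.apply_single (fun i => (newGenerators X₀ i).act j p σ) (fun _ => map_zero _)
      n x i).symm

/-- The inclusion of the generators of a stage. -/
noncomputable def ofStage :
    ∀ n, SymmSeqHom (stage X₀ n).M.toSymmSeq (limitCollection X₀).toSymmSeq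
  | 0 => ⟨fun _ _ => 0, fun _ _ => by simp⟩
  | n + 1 => desc (ofStage n) (singleGenerator X₀ n)

theorem ofStage_succ (n j : ℕ) (p : ℤ) (x : (stage X₀ n).M.obj j p)
    (y : (newGenerators X₀ n).obj j p) :
    (ofStage X₀ (n + 1)).toFun j p (x, y) =
      (ofStage X₀ n).toFun j p x + (singleGenerator X₀ n).toFun j p y := rfl

theorem toStage_succ (n j : ℕ) (p : ℤ) (m : (limitCollection X₀).obj j p) :
    (toStage X₀ (n + 1)).toFun j p m = ((toStage X₀ n).toFun j p m, m n) := rfl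

theorem singleGenerator_same (n j : ℕ) (p : ℤ) (y : (newGenerators X₀ n).obj j p) :
    (singleGenerator X₀ n).toFun j p y n = y :=
  Pi.single_eq_same (M := fun n => (newGenerators X₀ n).obj j p) n y

theorem singleGenerator_of_ne {n i : ℕ} (h : i ≠ n) (j : ℕ) (p : ℤ)
    (y : (newGenerators X₀ n).obj j p) : (singleGenerator X₀ n).toFun j p y i = 0 :=
  Pi.single_eq_of_ne (M := fun n => (newGenerators X₀ n).obj j p) h y

theorem add_limit_apply {j : ℕ} {p : ℤ} (x y : (limitCollection X₀).obj j p) (i : ℕ) :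
    (x + y) i = x i + y i := rfl

theorem toStage_singleGenerator {n i : ℕ} (h : n ≤ i) (j : ℕ) (p : ℤ)
    (y : (newGenerators X₀ i).obj j p) :
    (toStage X₀ n).toFun j p ((singleGenerator X₀ i).toFun j p y) = 0 := by
  induction n with
  | zero => rfl
  | succ n ih =>
    rw [toStage_succ, ih (by omega), singleGenerator_of_ne X₀ (by omega)]
    rfl

theorem ofStage_apply_of_le {n i : ℕ} (h : n ≤ i) (j : ℕ) (p : ℤ)
    (x : (stage X₀ n).M.obj j p) : (ofStage X₀ n).toFun j p x i = 0 := by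
  induction n with
  | zero => rfl
  | succ n ih =>
    obtain ⟨x, y⟩ := x
    rw [ofStage_succ, add_limit_apply, ih (by omega), singleGenerator_of_ne X₀ (by omega),
      add_zero]

theorem ofStage_toStage_apply {n i : ℕ} (h : i < n) (j : ℕ) (p : ℤ)
    (m : (limitCollection X₀).obj j p) :
    (ofStage X₀ n).toFun j p ((toStage X₀ n).toFun j p m) i = m i := by
  induction n with
  | zero => omega
  | succ n ih =>
    rw [toStage_succ, ofStage_succ, add_limit_apply]
    obtain h | rfl := Nat.lt_succ_iff_lt_or_eq.1 h
    · rw [ih h, singleGenerator_of_ne X₀ (by omega), add_zero]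
    · rw [ofStage_apply_of_le X₀ le_rfl, singleGenerator_same, zero_add]

theorem toStage_ofStage (n j : ℕ) (p : ℤ) (x : (stage X₀ n).M.obj j p) :
    (toStage X₀ n).toFun j p ((ofStage X₀ n).toFun j p x) = x := by
  induction n with
  | zero =>
    have : Subsingleton (X₀.M.obj j p) := by
      by_cases hj : j < 2
      · exact X₀.M.subsingleton_obj j p hj
      · exact X₀.subsingleton_obj j p (by omega)
    exact Subsingleton.elim (α := X₀.M.obj j p) _ _
  | succ n ih =>
    obtain ⟨x, y⟩ := x
    rw [toStage_succ, ofStage_succ, map_add, ih, toStage_singleGenerator X₀ le_rfl, add_zero,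
      add_limit_apply, ofStage_apply_of_le X₀ le_rfl, singleGenerator_same, zero_add]

/-- Generators added after stage n have arity at least n + 2. -/
theorem ofStage_toStage {n j : ℕ} (hj : j ≤ n + 1) (p : ℤ) (m : (limitCollection X₀).obj j p) :
    (ofStage X₀ n).toFun j p ((toStage X₀ n).toFun j p m) = m := by
  funext i
  by_cases h : i < n
  · exact ofStage_toStage_apply X₀ h j p m
  · have := (stage X₀ i).extension.subsingleton_obj j p (by omega)
    exact Subsingleton.elim _ _

/-- Elements of arity j involve only generators of arity ≤ j, so stage n agrees with the limit in
arities ≤ n + 1. -/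
theorem bijective_map_ofStage {n j : ℕ} (hj : j ≤ n + 1) (p : ℤ) :
    Function.Bijective ((map (ofStage X₀ n)).toFun j p) :=
  Function.bijective_iff_has_inverse.2 ⟨(map (toStage X₀ n)).toFun j p,
    map_map_of_le (ofStage X₀ n) (toStage X₀ n) j (fun i _ p x => toStage_ofStage X₀ n i p x)
      le_rfl,
    map_map_of_le (toStage X₀ n) (ofStage X₀ n) (n + 1)
      (fun _ hi p x => ofStage_toStage X₀ hi p x) hj⟩

theorem map_ofStage_inl {n j : ℕ} {p : ℤ} (x : (freeOperad (stage X₀ n).M).obj j p) :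
    (map (ofStage X₀ (n + 1))).toFun j p
        ((map ((stage X₀ n).M.inl (newGenerators X₀ n))).toFun j p x) =
      (map (ofStage X₀ n)).toFun j p x := by
  refine hom_eq (φ := (map (ofStage X₀ (n + 1))).comp
    (map ((stage X₀ n).M.inl (newGenerators X₀ n)))) (ψ := map (ofStage X₀ n))
    (fun j p x => congrArg (gen _ j p) ?_) x
  change (ofStage X₀ n).toFun j p x + (singleGenerator X₀ n).toFun j p 0 = _
  rw [map_zero, add_zero]

theorem toStage_succ_eq_inl {n j : ℕ} (hj : j ≠ n + 2) (p : ℤ)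
    (m : (limitCollection X₀).obj j p) :
    (toStage X₀ (n + 1)).toFun j p m =
      ((stage X₀ n).M.inl (newGenerators X₀ n)).toFun j p ((toStage X₀ n).toFun j p m) := by
  have := (stage X₀ n).extension.subsingleton_obj j p hj
  exact Prod.ext rfl (Subsingleton.elim (α := (newGenerators X₀ n).obj j p) _ _)

/-- The differential of a generator, computed in a stage. -/
theorem map_ofStage_d {n j : ℕ} (hj : j - 1 ≤ n) {p q : ℤ} (h : q + 1 = p)
    (m : (limitCollection X₀).obj j p) :
    (map (ofStage X₀ n)).toFun j q
        ((stage X₀ n).D.d j h (gen _ j p ((toStage X₀ n).toFun j p m))) =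
      (map (ofStage X₀ (j - 1))).toFun j q
        ((stage X₀ (j - 1)).D.d j h (gen _ j p ((toStage X₀ (j - 1)).toFun j p m))) := by
  induction n, hj using Nat.le_induction with
  | base => rfl
  | succ n hn ih =>
    rw [← ih, toStage_succ_eq_inl X₀ (by omega)]
    exact (congrArg ((map (ofStage X₀ (n + 1))).toFun j q) ((stage X₀ n).extension.d_inl j h
      (gen _ j p ((toStage X₀ n).toFun j p m)))).trans (map_ofStage_inl X₀ _)

/-- The value of the limit homomorphism on a generator, computed in a stage. -/
theorem ν_toStage {n j : ℕ} (hj : j - 1 ≤ n) (p : ℤ) (m : (limitCollection X₀).obj j p) :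
    (stage X₀ n).ν.toFun j p (gen _ j p ((toStage X₀ n).toFun j p m)) =
      (stage X₀ (j - 1)).ν.toFun j p (gen _ j p ((toStage X₀ (j - 1)).toFun j p m)) := by
  induction n, hj using Nat.le_induction with
  | base => rfl
  | succ n hn ih =>
    rw [← ih, toStage_succ_eq_inl X₀ (by omega)]
    exact (stage X₀ n).extension.ν_inl j p (gen _ j p ((toStage X₀ n).toFun j p m))

/-- The differential and ν on a generator are read off at the stage where it first appears; later
stages give the same values. Homology in arity n is then that of stage n. -/
theorem exists_minimal_model (hS : ∀ p, Subsingleton (S.obj 1 p)) :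
    ∃ (M : OperadCollection.{u, max u v} k) (D : OperadDifferential (freeOperad M))
      (ν : DGOperadHom D G), IsMinimal D ∧ ν.IsHomologyIso := by
  obtain ⟨X₀⟩ := ModelUpTo.nonempty_zero (G := G) hS
  have hgen : ∀ {n j : ℕ} (p : ℤ) (x : (stage X₀ n).M.obj j p),
      gen _ j p ((ofStage X₀ n).toFun j p x) = (map (ofStage X₀ n)).toFun j p (gen _ j p x) :=
    fun _ _ => rfl
  -- Generators of arity j ≥ 2 enter at stage j - 1; truncated subtraction is harmless in arity 0,
  -- where there are none.
  let δ : ∀ (j : ℕ) {p q : ℤ}, q + 1 = p →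
      ((limitCollection X₀).obj j p →ₗ[k] (freeOperad (limitCollection X₀)).obj j q) :=
    fun j p q h => (map (ofStage X₀ (j - 1))).toFun j q ∘ₗ (stage X₀ (j - 1)).D.d j h ∘ₗ
      gen _ j p ∘ₗ (toStage X₀ (j - 1)).toFun j p
  have hδ : ∀ (j : ℕ) {p q : ℤ} (h : q + 1 = p) (m : (limitCollection X₀).obj j p),
      δ j h m = (map (ofStage X₀ (j - 1))).toFun j q
        ((stage X₀ (j - 1)).D.d j h (gen _ j p ((toStage X₀ (j - 1)).toFun j p m))) :=
    fun _ _ _ _ _ => rfl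
  have hsub : ∀ n j p, n + 1 < j → ∀ x : (stage X₀ n).M.obj j p, x = 0 := fun n j p hj x =>
    have := (stage X₀ n).subsingleton_obj j p hj
    Subsingleton.elim _ _
  -- Stated for every derivation extending δ because it is used twice: to prove d² = 0, and then for
  -- the resulting differential.
  have hΔ : ∀ Δ : OperadDerivation (freeOperad (limitCollection X₀)) 1,
      (∀ (j : ℕ) {p q : ℤ} (h : q + 1 = p) (m : (limitCollection X₀).obj j p),
        Δ.toFun j h (gen _ j p m) = δ j h m) →
      ∀ (n j : ℕ) {p q : ℤ} (h : q + 1 = p) (x : (freeOperad (stage X₀ n).M).obj j p),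
        Δ.toFun j h ((map (ofStage X₀ n)).toFun j p x) =
          (map (ofStage X₀ n)).toFun j q ((stage X₀ n).D.d j h x) := by
    intro Δ hΔ n j p q h x
    refine derivation_map_of_gen (stage X₀ n).D Δ (map (ofStage X₀ n)) (fun j p q h x => ?_) h x
    by_cases hj : n + 1 < j
    · rw [hsub n j p hj x]
      simp only [map_zero]
    · rw [← hgen, hΔ, hδ, ← map_ofStage_d X₀ (by omega : j - 1 ≤ n), toStage_ofStage]
  obtain ⟨D, hD⟩ := exists_differential δ
    (by
      intro j p q h σ m
      rw [hδ, hδ, SymmSeqHom.map_act, gen_act, OperadDifferential.d_act, OperadHom.map_act])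
    (by
      intro Δ hΔ' j p q r h h' m
      rw [hδ, hΔ Δ hΔ', OperadDifferential.d_d, map_zero])
  have hD' : ∀ (n j : ℕ) {p q : ℤ} (h : q + 1 = p) (x : (freeOperad (stage X₀ n).M).obj j p),
      D.d j h ((map (ofStage X₀ n)).toFun j p x) =
        (map (ofStage X₀ n)).toFun j q ((stage X₀ n).D.d j h x) :=
    hΔ ⟨fun n _ _ h => D.d n h, fun h => D.d_act h, fun hn hp hp' hq' hs' h₁ h₂ i f g => by
      rw [one_mul, D.d_comp hn hp hp' hq' hs' h₁ h₂]⟩ hD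
  let φ : OperadHom (freeOperad (limitCollection X₀)) S := lift
    { toFun j p := (stage X₀ (j - 1)).ν.toFun j p ∘ₗ gen _ j p ∘ₗ (toStage X₀ (j - 1)).toFun j p
      map_act {j p} σ m := by
        simp only [LinearMap.comp_apply]
        rw [SymmSeqHom.map_act, gen_act, OperadHom.map_act] }
  have hφgen : ∀ j p m, φ.toFun j p (gen _ j p m) =
      (stage X₀ (j - 1)).ν.toFun j p (gen _ j p ((toStage X₀ (j - 1)).toFun j p m)) :=
    fun _ _ _ => rfl
  have hφ : ∀ n j p x, φ.toFun j p ((map (ofStage X₀ n)).toFun j p x) =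
      (stage X₀ n).ν.toFun j p x := by
    intro n j p x
    refine hom_eq (φ := φ.comp (map (ofStage X₀ n))) (ψ := (stage X₀ n).ν.toOperadHom)
      (fun j p x => ?_) x
    by_cases hj : n + 1 < j
    · rw [hsub n j p hj x]
      simp only [map_zero]
    · change φ.toFun j p (gen _ j p ((ofStage X₀ n).toFun j p x)) = _
      rw [hφgen, ← ν_toStage X₀ (by omega : j - 1 ≤ n), toStage_ofStage]
  let ν : DGOperadHom D G := ⟨φ, map_d_of_gen D G φ fun j p q h m => by
    rw [hD, hδ, hφ, hφgen, DGOperadHom.map_d]⟩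
  refine ⟨limitCollection X₀, D, ν, isMinimal_iff.2 fun j p q h m => ?_,
    ν.isHomologyIso_iff.2 fun n => ?_⟩
  · rw [hD, hδ]
    exact map_mem_decomposables _ ((stage X₀ (j - 1)).isMinimal.d_mem_decomposables h _)
  · exact DGOperadHom.homologyAt_of_bijective (D := (stage X₀ n).D)
      ⟨map (ofStage X₀ n), fun {j p q} h x => (hD' n j h x).symm⟩ (stage X₀ n).ν ν (hφ n)
      (bijective_map_ofStage X₀ (by omega)) ((stage X₀ n).homologyAt n (by omega))

end Models

end FreeOperad

theorem mainTheorem1 {k : Type u} [Field k] [CharZero k] (S : NonunitalOperad.{u, v} k)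
    (dS : OperadDifferential S) (hS : ∀ p, Subsingleton (S.obj 1 p)) :
    (∃ (M : OperadCollection.{u, max u v} k) (d : OperadDifferential (freeOperad M))
        (ν : DGOperadHom d dS), FreeOperad.IsMinimal d ∧ ν.IsHomologyIso) ∧
    (∀ (M : OperadCollection.{u, w} k) (d : OperadDifferential (freeOperad M))
        (ν : DGOperadHom d dS)
        (M' : OperadCollection.{u, w} k) (d' : OperadDifferential (freeOperad M'))
        (ν' : DGOperadHom d' dS),
        FreeOperad.IsMinimal d → ν.IsHomologyIso →
        FreeOperad.IsMinimal d' → ν'.IsHomologyIso →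
        Nonempty (DGOperadIso d d')) :=
  ⟨FreeOperad.exists_minimal_model hS, fun _ _ ν _ _ ν' hd hν hd' hν' =>
    FreeOperad.nonempty_dgOperadIso hS ν ν' hd hν hd' hν'⟩
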